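/- Let $\boldsymbol a_1,\dots,\boldsymbol a_m\in\mathbb R^n$ be random vectors whose $mn$ entries are i.i.d. $\mathcal N(0,1)$. For a finite sequence of reals $X_1,\dots,X_m$ let $\mathsf{med}(\{X_i\})=\inf\{t\in\mathbb R:\ \tfrac1m\#\{i: X_i\le t\}\ge \tfrac12\}$ be the sample median. For $\boldsymbol x\in\mathbb R^n$ consider the noise-free measurements $y_i=|\boldsymbol a_i^T\boldsymbol x|^2$, so that $\sqrt{y_i}=|\boldsymbol a_i^T\boldsymbol x|$, and for $\boldsymbol z\in\mathbb R^n$ define the median-truncated reshaped Wirtinger flow gradient $$\nabla\mathcal R_{tr}(\boldsymbol z)=\frac1m\sum_{i=1}^m\Big(\boldsymbol a_i^T\boldsymbol z-\sqrt{y_i}\cdot\frac{\boldsymbol a_i^T\boldsymbol z}{|\boldsymbol a_i^T\boldsymbol z|}\Big)\boldsymbol a_i\,\boldsymbol 1_{\mathcal T^i},\qquad \mathcal T^i=\Big\{\big|\sqrt{y_i}-|\boldsymbol a_i^T\boldsymbol z|\big|\le \alpha'_h\,\mathsf{med}\big(\{|\sqrt{y_k}-|\boldsymbol a_k^T\boldsymbol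 z||\}_{k=1}^m\big)\Big\},$$ with $\alpha'_h=5$ and the convention $0/|0|=0$. For $\xi\sim\mathcal N(0,1)$ put $$\zeta'_1=\zeta'_1(\boldsymbol x,\boldsymbol z)=1-\min\Big\{\mathbb E\big[\xi^2\boldsymbol 1_{\{\xi\ge 0.5\sqrt{1.01}\,\alpha'_h\|\boldsymbol z-\boldsymbol x\|/\|\boldsymbol x\|\}}\big],\ \mathbb E\big[\boldsymbol 1_{\{\xi\ge 0.5\sqrt{1.01}\,\alpha'_h\|\boldsymbol z-\boldsymbol x\|/\|\boldsymbol x\|\}}\big]\Big\},\qquad \zeta'_2=\mathbb E\big[\xi^2\boldsymbol 1_{\{|\xi|>0.5\sqrt{0.99}\,\alpha'_h\}}\big].$$ There are universal constants $c_0,c_1,c_2>0$ such that for every constant $\epsilon>0$ and all $m,n$ with $m>c_0\,n\log n$, with probability at least $1-c_1\exp(-c_2m)$, $$\big\langle\nabla\mathcal R_{tr}(\boldsymbol z),\boldsymbol z-\boldsymbol x\big\rangle\ \ge\ \{0.88-\zeta'_1-\zeta'_2-\epsilon\}\,\|\boldsymbol z-\boldsymbol x\|^2$$ holds simultaneously for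 all $\boldsymbol x,\boldsymbol z\in\mathbb R^n$ with $\boldsymbol z\ne\boldsymbol 0$ and $\|\boldsymbol z-\boldsymbol x\|/\|\boldsymbol z\|\le\frac1{20}$. -/

import Mathlib

open MeasureTheory ProbabilityTheory

noncomputable section

namespace MedianRWF

/-- The empirical distribution function of the sample `X 0, …, X (m - 1)`: the fraction of the
samples that are at most `t`. -/
def empiricalCDF {m : ℕ} (X : Fin m → ℝ) (t : ℝ) : ℝ :=
  ((Finset.univ.filter fun i => X i ≤ t).card : ℝ) / (m : ℝ)

/-- The sample `p`-quantile `inf {t : F(t) ≥ p}`, where `F` is the empirical distribution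
function (an honest minimum for `0 < p < 1` and at least one sample). -/
def sampleQuantile {m : ℕ} (p : ℝ) (X : Fin m → ℝ) : ℝ :=
  sInf {t : ℝ | p ≤ empiricalCDF X t}

/-- The sample median is the sample `1/2`-quantile. -/
def sampleMedian {m : ℕ} (X : Fin m → ℝ) : ℝ :=
  sampleQuantile (1 / 2) X

/-- The residuals `|√yᵢ - |aᵢᵀ z||`. -/
def residual {m n : ℕ} (a : Fin m → EuclideanSpace ℝ (Fin n)) (y : Fin m → ℝ)
    (z : EuclideanSpace ℝ (Fin n)) (i : Fin m) : ℝ :=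
  |√(y i) - (|inner ℝ (a i) z|)|

/-- The median-truncated gradient of the reshaped quadratic loss
`(1 / 2m) ∑ᵢ (√yᵢ - |aᵢᵀ z|)²` with truncation threshold `α`. The sign of `aᵢᵀ z` is
`aᵢᵀ z / |aᵢᵀ z|`, which is `0` when `aᵢᵀ z = 0`. -/
def truncatedGradient {m n : ℕ} (α : ℝ) (a : Fin m → EuclideanSpace ℝ (Fin n))
    (y : Fin m → ℝ) (z : EuclideanSpace ℝ (Fin n)) : EuclideanSpace ℝ (Fin n) :=
  (1 / (m : ℝ)) • ∑ i, if residual a y z i ≤ α * sampleMedian (residual a y z) then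
      (inner ℝ (a i) z - √(y i) * (inner ℝ (a i) z / |inner ℝ (a i) z|)) • a i
    else 0

/-- Noise-free intensity measurements `yᵢ = |⟨aᵢ, x⟩|²`. -/
def noiseFree {m n : ℕ} (a : Fin m → EuclideanSpace ℝ (Fin n))
    (x : EuclideanSpace ℝ (Fin n)) (i : Fin m) : ℝ :=
  |inner ℝ (a i) x| ^ 2

/-- `ζ'₁ = 1 - min {E[ξ² 1{ξ ≥ 0.5 √1.01 α r}], E[1{ξ ≥ 0.5 √1.01 α r}]}` for standard normal
`ξ`, as a function of the threshold `α` and the relative error `r`. -/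
def zeta₁ (α r : ℝ) : ℝ :=
  1 - min
    (∫ ξ : ℝ, {ξ : ℝ | 0.5 * √1.01 * α * r ≤ ξ}.indicator (fun ξ => ξ ^ 2) ξ ∂(gaussianReal 0 1))
    (∫ ξ : ℝ, {ξ : ℝ | 0.5 * √1.01 * α * r ≤ ξ}.indicator (fun _ => (1 : ℝ)) ξ
      ∂(gaussianReal 0 1))

/-- `ζ'₂ = E[ξ² 1{|ξ| > 0.5 √0.99 α}]` for standard normal `ξ`. -/
def zeta₂ (α : ℝ) : ℝ :=
  ∫ ξ : ℝ, {ξ : ℝ | 0.5 * √0.99 * α < |ξ|}.indicator (fun ξ => ξ ^ 2) ξ ∂(gaussianReal 0 1)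

/-- The `m n` entries of the random vectors `a₁, …, aₘ` in `ℝⁿ` are i.i.d. standard normal. -/
def IsGaussianSample {Ω : Type*} [MeasurableSpace Ω] (P : Measure Ω) {m n : ℕ}
    (a : Fin m → Ω → EuclideanSpace ℝ (Fin n)) : Prop :=
  (∀ i j, HasLaw (fun ω => a i ω j) (gaussianReal 0 1) P) ∧
    iIndepFun (fun (ij : Fin m × Fin n) ω => a ij.1 ω ij.2) P

end MedianRWF

end

noncomputable section

namespace MedianRWF

/-! The Gaussian tail probability inside `zeta₁` is at most 1/2 and `zeta₂` is nonnegative, so the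
claimed constant lies below 0.38, and it suffices to prove the bound with that fixed constant.

Put r = ‖z - x‖, let h and w be the unit directions of z - x and z, and write sᵢ = ⟨aᵢ, h⟩, tᵢ =
⟨aᵢ, w⟩. If |sᵢ| ≤ 20|tᵢ|, then |⟨aᵢ, z - x⟩| ≤ |⟨aᵢ, z⟩|, so ⟨aᵢ, x⟩ and ⟨aᵢ, z⟩ do not have
opposite signs, the residual is exactly r|sᵢ|, and an index that survives truncation contributes
r²sᵢ². Any other index contributes at least -r²sᵢ². More than half of the indices satisfy 1/2 < |sᵢ|
≤ 20|tᵢ|, so the median is at least r/2, and truncation at five medians keeps every index with |sᵢ|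
≤ min(2.5, 20|tᵢ|). Summing, the inner product is at least r²(2 · 0.76 - 1.12) = 0.4 r².

The three averages used here are bounded for all directions at once in `UniformBounds`. Indicators
are replaced by Lipschitz minorants so that a net argument applies: `integral_energyMinorant_ge` and
`integral_levelMinorant_ge` bound the means, `measure_sum_comp_le` and `measure_sum_inner_sq_ge` the
deviations at fixed directions, and `uniformBounds_of_net` passes to the whole sphere. The net has
exp(O(n log n)) points, which is what m > c₀ n log n pays for. -/

/-! ### One-dimensional Gaussian estimates. -/

theorem gaussianPDFReal_std (x : ℝ) :
    gaussianPDFReal 0 1 x = (√(2 * Real.pi))⁻¹ * Real.exp (-(x ^ 2 / 2)) := by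
  simp [gaussianPDFReal, neg_div]

theorem inv_sqrt_two_pi_le : (√(2 * Real.pi))⁻¹ ≤ 0.4 := by
  rw [show (0.4 : ℝ) = (2.5)⁻¹ by norm_num]
  apply inv_anti₀ (by norm_num)
  apply Real.le_sqrt_of_sq_le
  have := Real.pi_gt_d2
  norm_num at this ⊢
  linarith

theorem gaussianPDFReal_std_le (x : ℝ) : gaussianPDFReal 0 1 x ≤ 0.4 := by
  rw [gaussianPDFReal_std]
  have h1 : Real.exp (-(x ^ 2 / 2)) ≤ 1 := Real.exp_le_one_iff.2 (by nlinarith [sq_nonneg x])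
  have h2 := inv_sqrt_two_pi_le
  have h3 : 0 ≤ (√(2 * Real.pi))⁻¹ := by positivity
  have h4 := Real.exp_pos (-(x ^ 2 / 2))
  nlinarith

/-- The standard Gaussian small-ball bound. -/
theorem gaussianReal_abs_le (c : ℝ) (hc : 0 ≤ c) :
    (gaussianReal 0 1).real {x | |x| ≤ c} ≤ 0.8 * c := by
  have hset : {x : ℝ | |x| ≤ c} = Set.Icc (-c) c := by ext x; simp [abs_le]
  rw [hset, measureReal_def, gaussianReal_apply_eq_integral _ one_ne_zero, ENNReal.toReal_ofReal
    (setIntegral_nonneg measurableSet_Icc fun x _ => gaussianPDFReal_nonneg _ _ _)]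
  calc ∫ x in Set.Icc (-c) c, gaussianPDFReal 0 1 x
      ≤ ∫ x in Set.Icc (-c) c, (0.4 : ℝ) :=
        setIntegral_mono (integrable_gaussianPDFReal 0 1).integrableOn
          (integrableOn_const (by simp)) gaussianPDFReal_std_le
    _ = 0.8 * c := by
        rw [setIntegral_const, measureReal_def, Real.volume_Icc,
          ENNReal.toReal_ofReal (by linarith), smul_eq_mul]
        ring

theorem gaussianReal_Ici_zero_le : (gaussianReal 0 1).real (Set.Ici 0) ≤ 1 / 2 := by
  have := nullSingletonClass_gaussianReal (μ := 0) (v := 1) one_ne_zero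
  have h1 : (gaussianReal 0 1).real (Set.Ici 0) = (gaussianReal 0 1).real (Set.Iic 0) := by
    have h : (gaussianReal 0 1).map (fun x => -x) = gaussianReal 0 1 := by
      rw [gaussianReal_map_neg, neg_zero]
    conv_lhs => rw [← h]
    rw [measureReal_def, Measure.map_apply measurable_neg measurableSet_Ici, measureReal_def]
    congr 2
    ext x; simp
  have h2 : (gaussianReal 0 1).real (Set.Ici 0) = (gaussianReal 0 1).real (Set.Ioi 0) := by
    rw [measureReal_def, measureReal_def]
    congr 1
    exact (measure_congr Ioi_ae_eq_Ici).symm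
  have h3 : (gaussianReal 0 1).real (Set.Iic 0) + (gaussianReal 0 1).real (Set.Ioi 0) = 1 := by
    rw [← measureReal_union (by simp [Set.disjoint_left]) measurableSet_Ioi, Set.Iic_union_Ioi]
    simp
  linarith

theorem integrable_sq_gaussianReal (v : NNReal) :
    Integrable (fun x : ℝ => x ^ 2) (gaussianReal 0 v) :=
  (memLp_id_gaussianReal 2).integrable_sq

theorem integral_sq_gaussianReal (v : NNReal) : ∫ x : ℝ, x ^ 2 ∂(gaussianReal 0 v) = v := by
  have h := variance_fun_id_gaussianReal (μ := 0) (v := v)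
  rw [variance_eq_integral (by fun_prop)] at h
  simpa using h

theorem integrable_exp_sq_gaussianReal :
    Integrable (fun x : ℝ => Real.exp (1 / 20 * x ^ 2)) (gaussianReal 0 1) := by
  rw [gaussianReal_of_var_ne_zero _ one_ne_zero]
  unfold gaussianPDF
  rw [integrable_withDensity_iff_integrable_smul₀' (by fun_prop) (by simp)]
  have : (fun x : ℝ => (ENNReal.ofReal (gaussianPDFReal 0 1 x)).toReal • Real.exp (1 / 20 * x ^ 2))
      = fun x => (√(2 * Real.pi))⁻¹ * Real.exp (-(9 / 20) * x ^ 2) := by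
    ext x
    rw [ENNReal.toReal_ofReal (gaussianPDFReal_nonneg _ _ _), gaussianPDFReal_std, smul_eq_mul,
      mul_assoc, ← Real.exp_add]
    ring_nf
  rw [this]
  exact (integrable_exp_neg_mul_sq (by norm_num)).const_mul _

theorem integral_exp_sq_gaussianReal :
    ∫ x : ℝ, Real.exp (1 / 20 * x ^ 2) ∂(gaussianReal 0 1) = √(10 / 9) := by
  rw [integral_gaussianReal_eq_integral_smul one_ne_zero]
  have : (fun x : ℝ => gaussianPDFReal 0 1 x • Real.exp (1 / 20 * x ^ 2))
      = fun x => (√(2 * Real.pi))⁻¹ * Real.exp (-(9 / 20) * x ^ 2) := by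
    ext x
    rw [gaussianPDFReal_std, smul_eq_mul, mul_assoc, ← Real.exp_add]
    ring_nf
  rw [this, integral_const_mul, integral_gaussian, ← Real.sqrt_inv,
    ← Real.sqrt_mul (by positivity)]
  congr 1
  have := Real.pi_ne_zero
  field_simp
  norm_num

/-- An antiderivative bound for the second moment of the Gaussian tail. -/
theorem integral_Ioi_sq_mul_exp_le (K : ℝ) (hK : 0 < K) :
    ∫ x in Set.Ioi K, x ^ 2 * Real.exp (-(x ^ 2 / 2)) ≤ (K + K⁻¹) * Real.exp (-(K ^ 2 / 2)) := by
  -- The derivative exceeds the wanted integrand only by the nonnegative x⁻² term, so this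
  -- elementary primitive bounds the tail from above.
  have hderiv : ∀ x ∈ Set.Ici K, HasDerivAt (fun x : ℝ => -((x + x⁻¹) * Real.exp (-(x ^ 2 / 2))))
      ((x ^ 2 + (x ^ 2)⁻¹) * Real.exp (-(x ^ 2 / 2))) x := by
    intro x hx
    have hx0 : x ≠ 0 := (lt_of_lt_of_le hK hx).ne'
    have h1 := ((hasDerivAt_id x).add (hasDerivAt_inv hx0))
    have h2 : HasDerivAt (fun x : ℝ => Real.exp (-(x ^ 2 / 2))) (Real.exp (-(x ^ 2 / 2)) * (-x)) x := by
      apply HasDerivAt.exp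
      convert! ((hasDerivAt_pow 2 x).div_const 2).neg using 1
      norm_num
    convert! (h1.mul h2).neg using 1
    simp only [id, Pi.add_apply]
    field_simp
    ring
  have hpos : ∀ x ∈ Set.Ioi K, 0 ≤ (x ^ 2 + (x ^ 2)⁻¹) * Real.exp (-(x ^ 2 / 2)) :=
    fun x _ => by positivity
  have hlim : Filter.Tendsto (fun x : ℝ => -((x + x⁻¹) * Real.exp (-(x ^ 2 / 2)))) Filter.atTop
      (nhds 0) := by
    have h1 : Filter.Tendsto (fun x : ℝ => x ^ 2 * Real.exp (-x)) Filter.atTop (nhds 0) :=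
      Real.tendsto_pow_mul_exp_neg_atTop_nhds_zero 2
    rw [← neg_zero]
    refine Filter.Tendsto.neg ?_
    refine squeeze_zero' ?_ ?_ h1
    · filter_upwards [Filter.eventually_ge_atTop 2] with x hx
      positivity
    · filter_upwards [Filter.eventually_ge_atTop 2] with x hx
      have : x⁻¹ ≤ 1 := inv_le_one_of_one_le₀ (by linarith)
      have h3 : Real.exp (-(x ^ 2 / 2)) ≤ Real.exp (-x) := Real.exp_le_exp.2 (by nlinarith)
      have : 0 < x⁻¹ := by positivity
      exact mul_le_mul (by nlinarith) h3 (Real.exp_pos _).le (by positivity)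
  have hint := integral_Ioi_of_hasDerivAt_of_nonneg' hderiv hpos hlim
  have hI := integrableOn_Ioi_deriv_of_nonneg' hderiv hpos hlim
  have hI2 : IntegrableOn (fun x : ℝ => x ^ 2 * Real.exp (-(x ^ 2 / 2))) (Set.Ioi K) := by
    refine Integrable.mono' hI (by fun_prop) ?_
    filter_upwards with x
    rw [Real.norm_of_nonneg (by positivity)]
    gcongr
    linarith [show 0 ≤ (x ^ 2)⁻¹ by positivity]
  calc _ ≤ ∫ x in Set.Ioi K, (x ^ 2 + (x ^ 2)⁻¹) * Real.exp (-(x ^ 2 / 2)) := by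
        refine setIntegral_mono_on hI2 hI measurableSet_Ioi fun x hx => ?_
        gcongr
        linarith [show 0 ≤ (x ^ 2)⁻¹ by positivity]
    _ = _ := by rw [hint]; ring

theorem exp_neg_tail_le : Real.exp (-((2.49 : ℝ) ^ 2 / 2)) ≤ 0.0455 := by
  rw [show (-((2.49 : ℝ) ^ 2 / 2)) = ((3 : ℕ) : ℝ) * (-1) + (-0.10005) by norm_num,
    Real.exp_add, Real.exp_nat_mul]
  have h1 : Real.exp (-1) < 0.3678794412 := Real.exp_neg_one_lt_d9
  have h2 : Real.exp (-0.10005) ≤ 0.905 := by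
    rw [Real.exp_neg]
    have := Real.quadratic_le_exp_of_nonneg (x := 0.10005) (by norm_num)
    rw [show (0.905 : ℝ) = (0.905⁻¹)⁻¹ by norm_num]
    apply inv_anti₀ (by norm_num)
    refine le_trans ?_ this
    norm_num
  calc _ ≤ (0.3678794412 : ℝ) ^ 3 * 0.905 := by gcongr
    _ ≤ 0.0455 := by norm_num

/-- The truncated second moment of a standard Gaussian. -/
theorem integral_sq_indicator_ge :
    0.89 ≤ ∫ x : ℝ, {x : ℝ | |x| ≤ 2.49}.indicator (fun x => x ^ 2) x ∂(gaussianReal 0 1) := by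
  have hm : MeasurableSet {x : ℝ | |x| ≤ 2.49} := measurableSet_le (by fun_prop) (by fun_prop)
  rw [integral_indicator hm]
  have h1 := integral_add_compl hm (integrable_sq_gaussianReal 1)
  rw [integral_sq_gaussianReal] at h1
  have hc : {x : ℝ | |x| ≤ 2.49}ᶜ = Set.Iio (-2.49) ∪ Set.Ioi 2.49 := by
    ext x
    simp only [Set.mem_compl_iff, Set.mem_ofPred_eq, not_le, lt_abs, Set.mem_union, Set.mem_Iio,
      Set.mem_Ioi]
    constructor <;> rintro (h | h)
    · exact Or.inr h
    · exact Or.inl (by linarith)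
    · exact Or.inr (by linarith)
    · exact Or.inl h
  have hI : Integrable (fun x : ℝ => x ^ 2 * Real.exp (-(x ^ 2 / 2))) := by
    have := integrable_rpow_mul_exp_neg_mul_sq (b := 1 / 2) (by norm_num) (s := 2) (by norm_num)
    refine this.congr (Filter.Eventually.of_forall fun x => ?_)
    simp only [Real.rpow_ofNat]
    ring_nf
  have hset : ∀ s : Set ℝ, MeasurableSet s → ∫ x in s, x ^ 2 ∂(gaussianReal 0 1)
      = (√(2 * Real.pi))⁻¹ * ∫ x in s, x ^ 2 * Real.exp (-(x ^ 2 / 2)) := by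
    intro s hs
    rw [← integral_indicator hs, integral_gaussianReal_eq_integral_smul one_ne_zero,
      ← integral_const_mul, ← integral_indicator hs]
    congr 1 with x
    by_cases hx : x ∈ s
    · simp only [hx, Set.indicator_of_mem, gaussianPDFReal_std, smul_eq_mul]; ring
    · simp [hx]
  have hsym : ∫ x in Set.Iio (-2.49 : ℝ), x ^ 2 * Real.exp (-(x ^ 2 / 2))
      = ∫ x in Set.Ioi (2.49 : ℝ), x ^ 2 * Real.exp (-(x ^ 2 / 2)) := by
    rw [← integral_Iic_eq_integral_Iio, ← integral_comp_neg_Ioi]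
    simp
  rw [hset _ hm.compl, hc, setIntegral_union (by
      rw [Set.disjoint_left]; intro x hx hx'
      simp only [Set.mem_Iio, Set.mem_Ioi] at hx hx'; linarith) measurableSet_Ioi
      hI.integrableOn hI.integrableOn, hsym] at h1
  have h2 := integral_Ioi_sq_mul_exp_le 2.49 (by norm_num)
  have h3 := inv_sqrt_two_pi_le
  have h4 := exp_neg_tail_le
  have h5 : 0 ≤ ∫ x in Set.Ioi (2.49 : ℝ), x ^ 2 * Real.exp (-(x ^ 2 / 2)) :=
    setIntegral_nonneg measurableSet_Ioi fun x _ => by positivity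
  have h6 : ∫ x in Set.Ioi (2.49 : ℝ), x ^ 2 * Real.exp (-(x ^ 2 / 2)) ≤ 0.1332 := by
    refine h2.trans ?_
    calc (2.49 + (2.49 : ℝ)⁻¹) * Real.exp (-((2.49 : ℝ) ^ 2 / 2))
      _ ≤ (2.49 + (2.49 : ℝ)⁻¹) * 0.0455 := by gcongr
      _ ≤ 0.1332 := by norm_num
  have h7 : 0 ≤ (√(2 * Real.pi))⁻¹ := by positivity
  push_cast at h1
  -- Numerically 1 - 2 · 0.4 · 0.1332 > 0.89.
  nlinarith [mul_le_mul h3 h6 h5 (by norm_num)]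


/-! ### Lipschitz minorants and their means over two Gaussian directions. -/

section Directions

/-- A Lipschitz minorant of `s ^ 2` on the event `|s| ≤ min 2.5 (20 * |t|)`. -/
def energyMinorant (s t : ℝ) : ℝ :=
  max 0 (min ((min |s| 2.5) ^ 2) (min (625 * (2.5 - |s|)) (625 * (20 * |t| - |s|))))

/-- A Lipschitz minorant of the indicator of the event `1 / 2 < |s| ≤ 20 * |t|`. -/
def levelMinorant (s t : ℝ) : ℝ :=
  max 0 (min 1 (min (100 * (|s| - 1 / 2)) (100 * (20 * |t| - |s|))))

theorem energyMinorant_nonneg (s t : ℝ) : 0 ≤ energyMinorant s t := le_max_left _ _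

theorem levelMinorant_nonneg (s t : ℝ) : 0 ≤ levelMinorant s t := le_max_left _ _

theorem energyMinorant_le_seven (s t : ℝ) : energyMinorant s t ≤ 7 := by
  have h1 : min |s| (2.5 : ℝ) ≤ 2.5 := min_le_right _ _
  have h2 : 0 ≤ min |s| (2.5 : ℝ) := le_min (abs_nonneg _) (by norm_num)
  exact max_le (by norm_num) ((min_le_left _ _).trans (by nlinarith))

theorem levelMinorant_le_one (s t : ℝ) : levelMinorant s t ≤ 1 :=
  max_le (by norm_num) (min_le_left _ _)

theorem energyMinorant_le_sq (s t : ℝ) : energyMinorant s t ≤ s ^ 2 := by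
  have h2 : 0 ≤ min |s| (2.5 : ℝ) := le_min (abs_nonneg _) (by norm_num)
  refine max_le (sq_nonneg _) ((min_le_left _ _).trans ?_)
  rw [← sq_abs s]
  exact pow_le_pow_left₀ h2 (min_le_left _ _) 2

theorem energyMinorant_eq_zero {s t : ℝ} (h : ¬(|s| ≤ 2.5 ∧ |s| ≤ 20 * |t|)) :
    energyMinorant s t = 0 := by
  refine max_eq_left ((min_le_right _ _).trans ?_)
  by_cases h1 : |s| ≤ 2.5
  · have : 20 * |t| < |s| := not_le.1 fun h' => h ⟨h1, h'⟩
    exact (min_le_right _ _).trans (by linarith)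
  · exact (min_le_left _ _).trans (by linarith)

theorem levelMinorant_eq_zero {s t : ℝ} (h : ¬(1 / 2 < |s| ∧ |s| ≤ 20 * |t|)) :
    levelMinorant s t = 0 := by
  refine max_eq_left ((min_le_right _ _).trans ?_)
  by_cases h1 : 1 / 2 < |s|
  · have : 20 * |t| < |s| := not_le.1 fun h' => h ⟨h1, h'⟩
    exact (min_le_right _ _).trans (by linarith)
  · exact (min_le_left _ _).trans (by linarith)

theorem abs_max_zero_sub_le (a b : ℝ) : |max 0 a - max 0 b| ≤ |a - b| := by
  simpa using abs_max_sub_max_le_max 0 a 0 b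

theorem abs_min_sub_min_le_of_le {a b c d M : ℝ} (h1 : |a - c| ≤ M) (h2 : |b - d| ≤ M) :
    |min a b - min c d| ≤ M :=
  (abs_min_sub_min_le_max a b c d).trans (max_le h1 h2)

/-- The steepest piece is 625 · 20|t|, whence 12500. Capping |s| at 2.5 before squaring is what
makes the quadratic piece Lipschitz. -/
theorem abs_energyMinorant_sub_le (s t s' t' : ℝ) :
    |energyMinorant s t - energyMinorant s' t'| ≤ 12500 * (|s - s'| + |t - t'|) := by
  have hs := abs_abs_sub_abs_le_abs_sub s s'
  have ht := abs_abs_sub_abs_le_abs_sub t t'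
  have hs0 := abs_nonneg (s - s')
  have ht0 := abs_nonneg (t - t')
  refine (abs_max_zero_sub_le _ _).trans (abs_min_sub_min_le_of_le ?_ (abs_min_sub_min_le_of_le ?_ ?_))
  · have h1 : |min |s| 2.5 - min |s'| 2.5| ≤ |s - s'| :=
      abs_min_sub_min_le_of_le hs (by simp)
    have a1 : min |s| (2.5 : ℝ) ≤ 2.5 := min_le_right _ _
    have a2 : 0 ≤ min |s| (2.5 : ℝ) := le_min (abs_nonneg _) (by norm_num)
    have b1 : min |s'| (2.5 : ℝ) ≤ 2.5 := min_le_right _ _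
    have b2 : 0 ≤ min |s'| (2.5 : ℝ) := le_min (abs_nonneg _) (by norm_num)
    rw [sq_sub_sq, abs_mul, abs_of_nonneg (by positivity : 0 ≤ min |s| 2.5 + min |s'| (2.5 : ℝ))]
    nlinarith [abs_nonneg (min |s| 2.5 - min |s'| (2.5 : ℝ))]
  · rw [abs_le] at hs ⊢; constructor <;> linarith
  · rw [abs_le] at hs ht ⊢; constructor <;> linarith

theorem abs_levelMinorant_sub_le (s t s' t' : ℝ) :
    |levelMinorant s t - levelMinorant s' t'| ≤ 12500 * (|s - s'| + |t - t'|) := by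
  have hs := abs_abs_sub_abs_le_abs_sub s s'
  have ht := abs_abs_sub_abs_le_abs_sub t t'
  have hs0 := abs_nonneg (s - s')
  have ht0 := abs_nonneg (t - t')
  refine (abs_max_zero_sub_le _ _).trans (abs_min_sub_min_le_of_le ?_ (abs_min_sub_min_le_of_le ?_ ?_))
  · simp; positivity
  · rw [abs_le] at hs ⊢; constructor <;> linarith
  · rw [abs_le] at hs ht ⊢; constructor <;> linarith

/-- The event that `t` is too small compared to `g`; it contains `20 * |t| < |ρ * t + g| + 0.01`
for all `|ρ| ≤ 1`. -/
def smallRatio : Set (ℝ × ℝ) := {p | 19 * |p.1| ≤ |p.2| + 0.01}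

theorem measurableSet_smallRatio : MeasurableSet smallRatio :=
  measurableSet_le (by fun_prop) (by fun_prop)

/-- With slope 625 = 2.5² / 0.01, a margin of 0.01 in both constraints already gives the full
square. Where the margin to 20|t| fails, t is small compared with g, and the loss s² ≤ 2.5|s| is
bounded through |s| ≤ |t| + |g| by a function of g alone. -/
theorem energyMinorant_ge {ρ : ℝ} (hρ : |ρ| ≤ 1) (t g : ℝ) :
    {x : ℝ | |x| ≤ 2.49}.indicator (fun x => x ^ 2) (ρ * t + g)
      - smallRatio.indicator (fun p => 2.5 * ((20 * |p.2| + 0.01) / 19)) (t, g)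
      ≤ energyMinorant (ρ * t + g) t := by
  have hn := energyMinorant_nonneg (ρ * t + g) t
  have hi : 0 ≤ smallRatio.indicator (fun p : ℝ × ℝ => 2.5 * ((20 * |p.2| + 0.01) / 19)) (t, g) :=
    Set.indicator_nonneg (fun p _ => by positivity) _
  have hst : |ρ * t + g| ≤ |t| + |g| := by
    refine (abs_add_le _ _).trans ?_
    rw [abs_mul]
    nlinarith [abs_nonneg t]
  by_cases h1 : |ρ * t + g| ≤ 2.49
  · rw [Set.indicator_of_mem (show ρ * t + g ∈ {x : ℝ | |x| ≤ 2.49} from h1)]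
    by_cases h2 : |ρ * t + g| + 0.01 ≤ 20 * |t|
    · suffices h : (ρ * t + g) ^ 2 ≤ energyMinorant (ρ * t + g) t by linarith
      have h3 : |ρ * t + g| ^ 2 ≤ 6.25 := by nlinarith [abs_nonneg (ρ * t + g)]
      refine le_max_of_le_right (le_min ?_ (le_min ?_ ?_))
      · rw [min_eq_left (by linarith), sq_abs]
      · rw [← sq_abs]; linarith
      · rw [← sq_abs]; linarith
    · have h3 : (t, g) ∈ smallRatio := by
        simp only [smallRatio, Set.mem_ofPred_eq]; linarith
      rw [Set.indicator_of_mem h3]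
      simp only [smallRatio, Set.mem_ofPred_eq] at h3
      have h4 : (ρ * t + g) ^ 2 ≤ 2.5 * |ρ * t + g| := by
        rw [← sq_abs]; nlinarith [abs_nonneg (ρ * t + g)]
      have h5 : |ρ * t + g| ≤ (20 * |g| + 0.01) / 19 := by
        rw [le_div_iff₀ (by norm_num)]; linarith
      simp only
      linarith
  · rw [Set.indicator_of_notMem (show ρ * t + g ∉ {x : ℝ | |x| ≤ 2.49} from h1)]
    linarith

theorem levelMinorant_ge {ρ : ℝ} (hρ : |ρ| ≤ 1) (t g : ℝ) :
    1 - {x : ℝ | |x| ≤ 0.51}.indicator (fun _ => (1 : ℝ)) (ρ * t + g)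
      - smallRatio.indicator (fun _ => (1 : ℝ)) (t, g) ≤ levelMinorant (ρ * t + g) t := by
  have hn := levelMinorant_nonneg (ρ * t + g) t
  have hi : 0 ≤ smallRatio.indicator (fun _ => (1 : ℝ)) (t, g) :=
    Set.indicator_nonneg (fun p _ => by norm_num) _
  have hst : |ρ * t + g| ≤ |t| + |g| := by
    refine (abs_add_le _ _).trans ?_
    rw [abs_mul]
    nlinarith [abs_nonneg t]
  by_cases h1 : |ρ * t + g| ≤ 0.51
  · rw [Set.indicator_of_mem (show ρ * t + g ∈ {x : ℝ | |x| ≤ 0.51} from h1)]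
    linarith
  · rw [Set.indicator_of_notMem (show ρ * t + g ∉ {x : ℝ | |x| ≤ 0.51} from h1)]
    by_cases h2 : |ρ * t + g| + 0.01 ≤ 20 * |t|
    · suffices h : 1 ≤ levelMinorant (ρ * t + g) t by linarith
      exact le_max_of_le_right (le_min le_rfl (le_min (by linarith) (by linarith)))
    · have h3 : (t, g) ∈ smallRatio := by
        simp only [smallRatio, Set.mem_ofPred_eq]; linarith
      rw [Set.indicator_of_mem h3]
      linarith

/-- For fixed g, the event confines t to an interval of half-width (|g| + 0.01) / 19. The small-ball
bound and Fubini do the rest. -/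
theorem integral_smallRatio_le (v : NNReal) {u : ℝ → ℝ} (hu : ∀ g, 0 ≤ u g) 
    (hi : Integrable (fun g => u g * (|g| + 0.01)) (gaussianReal 0 v))
    (hi0 : Integrable u (gaussianReal 0 v)) :
    Integrable (smallRatio.indicator fun p => u p.2)
        ((gaussianReal 0 1).prod (gaussianReal 0 v)) ∧
      ∫ p, smallRatio.indicator (fun p => u p.2) p ∂((gaussianReal 0 1).prod (gaussianReal 0 v))
        ≤ 0.8 / 19 * ∫ g, u g * (|g| + 0.01) ∂(gaussianReal 0 v) := by
  have hint : Integrable (smallRatio.indicator fun p : ℝ × ℝ => u p.2)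
      ((gaussianReal 0 1).prod (gaussianReal 0 v)) :=
    (hi0.comp_snd _).indicator measurableSet_smallRatio
  refine ⟨hint, ?_⟩
  rw [integral_prod_symm _ hint, ← integral_const_mul]
  refine integral_mono hint.integral_prod_right (hi.const_mul _) fun g => ?_
  have hset : (fun t => smallRatio.indicator (fun p : ℝ × ℝ => u p.2) (t, g))
      = {t : ℝ | |t| ≤ (|g| + 0.01) / 19}.indicator fun _ => u g := by
    ext t
    have : (t, g) ∈ smallRatio ↔ t ∈ {t : ℝ | |t| ≤ (|g| + 0.01) / 19} := by
      simp only [smallRatio, Set.mem_ofPred_eq]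
      rw [le_div_iff₀ (by norm_num), mul_comm]
    by_cases h : (t, g) ∈ smallRatio
    · rw [Set.indicator_of_mem h, Set.indicator_of_mem (this.1 h)]
    · rw [Set.indicator_of_notMem h, Set.indicator_of_notMem (fun h' => h (this.2 h'))]
  simp only
  rw [hset, integral_indicator_const _ (measurableSet_le (by fun_prop) (by fun_prop)), smul_eq_mul]
  have := gaussianReal_abs_le ((|g| + 0.01) / 19) (by positivity)
  calc _ ≤ 0.8 * ((|g| + 0.01) / 19) * u g := by gcongr; exact hu g
    _ = _ := by ring

theorem integral_abs_gaussianReal_le {v : NNReal} (hv : v ≤ 1) :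
    ∫ g : ℝ, |g| ∂(gaussianReal 0 v) ≤ 1 := by
  have hi := integrable_sq_gaussianReal v
  have h1 : Integrable (fun g : ℝ => (1 + g ^ 2) / 2) (gaussianReal 0 v) :=
    ((integrable_const 1).add hi).div_const 2
  have habs : Integrable (fun g : ℝ => |g|) (gaussianReal 0 v) :=
    ((memLp_id_gaussianReal 1).integrable (by simp)).abs
  calc _ ≤ ∫ g : ℝ, (1 + g ^ 2) / 2 ∂(gaussianReal 0 v) :=
        integral_mono habs h1 fun g => by
          simp only; rw [← sq_abs]; nlinarith [sq_nonneg (|g| - 1)]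
    _ = (1 + v) / 2 := by
        rw [integral_div, integral_add (integrable_const 1) hi, integral_sq_gaussianReal]; simp
    _ ≤ 1 := by
        have : (v : ℝ) ≤ 1 := by exact_mod_cast hv
        linarith

variable {E : Type*} [NormedAddCommGroup E] [InnerProductSpace ℝ E] [FiniteDimensional ℝ E]
  [MeasurableSpace E] [BorelSpace E]

theorem map_inner_stdGaussian (h : E) :
    (stdGaussian E).map (fun x => inner ℝ x h) = gaussianReal 0 (‖h‖₊ ^ 2) := by
  have hfun : (fun x : E => inner ℝ x h) = innerSL ℝ h := by
    ext x; simp [real_inner_comm]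
  have hg : HasGaussianLaw (innerSL ℝ h) (stdGaussian E) :=
    IsGaussian.hasGaussianLaw_id.map (innerSL ℝ h)
  rw [hfun, hg.map_eq_gaussianReal, integral_strongDual_stdGaussian, variance_dual_stdGaussian,
    innerSL_apply_norm]
  congr 1
  ext
  simp

theorem map_inner_prod_stdGaussian {w g : E} (hwg : inner ℝ w g = 0) :
    (stdGaussian E).map (fun x => (inner ℝ x w, inner ℝ x g))
      = (gaussianReal 0 (‖w‖₊ ^ 2)).prod (gaussianReal 0 (‖g‖₊ ^ 2)) := by
  have hfun : ∀ h : E, (fun x : E => inner ℝ x h) = innerSL ℝ h := by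
    intro h; ext x; simp [real_inner_comm]
  have hL : HasGaussianLaw (fun x => (inner ℝ x w, inner ℝ x g)) (stdGaussian E) := by
    have := (IsGaussian.hasGaussianLaw_id (μ := stdGaussian E)).map
      ((innerSL ℝ w).prod (innerSL ℝ g))
    have hf : (fun x : E => (inner ℝ x w, inner ℝ x g))
        = (innerSL ℝ w).prod (innerSL ℝ g) ∘ id := by
      ext x <;> simp [real_inner_comm]
    rw [hf]
    exact this
  have hcov : cov[fun x => inner ℝ x w, fun x => inner ℝ x g; stdGaussian E] = 0 := by
    have := covarianceBilin_apply_eq_cov (μ := stdGaussian E) IsGaussian.memLp_two_id w g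
    rw [covarianceBilin_stdGaussian] at this
    simp only [real_inner_comm] at this ⊢
    rw [← this]
    exact hwg
  have hind := hL.indepFun_of_covariance_eq_zero hcov
  rw [(indepFun_iff_map_prod_eq_prod_map_map (by fun_prop) (by fun_prop)).1 hind,
    map_inner_stdGaussian, map_inner_stdGaussian]

/-- Any function of two unit directions of a Gaussian vector has the law of the same function of
`(ρ * t + g, t)`, with `t` standard Gaussian and `g` an independent Gaussian. -/
theorem exists_map_inner_eq {h w : E} (hh : ‖h‖ = 1) (hw : ‖w‖ = 1) :
    ∃ ρ : ℝ, |ρ| ≤ 1 ∧ ∃ v : NNReal, v ≤ 1 ∧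
      (stdGaussian E).map (fun x => (inner ℝ x h, inner ℝ x w))
        = ((gaussianReal 0 1).prod (gaussianReal 0 v)).map fun p => (ρ * p.1 + p.2, p.1) := by
  -- Split h into its projection ρw and an orthogonal remainder; orthogonal directions of a Gaussian
  -- vector are independent.
  set ρ : ℝ := inner ℝ w h with hρ
  have hρ1 : |ρ| ≤ 1 := by simpa [hh, hw] using abs_real_inner_le_norm w h
  have horth : inner ℝ w (h - ρ • w) = 0 := by
    rw [inner_sub_right, inner_smul_right, real_inner_self_eq_norm_sq, hw]; simp [hρ]
  refine ⟨ρ, hρ1, ‖h - ρ • w‖₊ ^ 2, ?_, ?_⟩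
  · rw [← NNReal.coe_le_coe]
    push_cast
    rw [norm_sub_sq_real, inner_smul_right, norm_smul, hh, hw, real_inner_comm, ← hρ,
      Real.norm_eq_abs]
    nlinarith [sq_abs ρ, sq_nonneg ρ]
  · have h1 : gaussianReal 0 1 = gaussianReal 0 (‖w‖₊ ^ 2) := by
      congr 1; ext; simp [hw]
    rw [h1, ← map_inner_prod_stdGaussian horth, Measure.map_map (by fun_prop) (by fun_prop)]
    congr 1
    ext x
    · simp [inner_sub_right, inner_smul_right]
    · simp

theorem measurable_energyMinorant : Measurable fun p : ℝ × ℝ => energyMinorant p.1 p.2 := by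
  unfold energyMinorant; fun_prop

theorem measurable_levelMinorant : Measurable fun p : ℝ × ℝ => levelMinorant p.1 p.2 := by
  unfold levelMinorant; fun_prop

theorem integral_comp_map_inner {h w : E} (F : ℝ × ℝ → ℝ) (hF : Measurable F) {μ : Measure (ℝ × ℝ)}
    {ρ : ℝ} (hμ : (stdGaussian E).map (fun x => (inner ℝ x h, inner ℝ x w))
      = μ.map fun p => (ρ * p.1 + p.2, p.1)) :
    ∫ x, F (inner ℝ x h, inner ℝ x w) ∂(stdGaussian E)
      = ∫ p, F (ρ * p.1 + p.2, p.1) ∂μ := by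
  have h1 := integral_map (μ := stdGaussian E) (φ := fun x => (inner ℝ x h, inner ℝ x w))
    (by fun_prop) (hF.aestronglyMeasurable)
  have h2 := integral_map (μ := μ) (φ := fun p : ℝ × ℝ => (ρ * p.1 + p.2, p.1))
    (by fun_prop) (hF.aestronglyMeasurable)
  rw [← h1, hμ, h2]

theorem integral_comp_map_inner_fst {h w : E} (hh : ‖h‖ = 1) (F : ℝ → ℝ) (hF : Measurable F)
    {μ : Measure (ℝ × ℝ)}
    {ρ : ℝ} (hμ : (stdGaussian E).map (fun x => (inner ℝ x h, inner ℝ x w))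
      = μ.map fun p => (ρ * p.1 + p.2, p.1)) :
    ∫ p, F (ρ * p.1 + p.2) ∂μ = ∫ s, F s ∂(gaussianReal 0 1) := by
  rw [← integral_comp_map_inner (fun p => F p.1) (by fun_prop) hμ]
  have h1 : gaussianReal 0 1 = gaussianReal 0 (‖h‖₊ ^ 2) := by
    congr 1; ext; simp [hh]
  rw [h1, ← map_inner_stdGaussian, integral_map (by fun_prop) hF.aestronglyMeasurable]

theorem integral_energyMinorant_ge {h w : E} (hh : ‖h‖ = 1) (hw : ‖w‖ = 1) :
    0.775 ≤ ∫ x, energyMinorant (inner ℝ x h) (inner ℝ x w) ∂(stdGaussian E) := by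
  obtain ⟨ρ, hρ, v, hv, hμ⟩ := exists_map_inner_eq hh hw
  set μ := (gaussianReal 0 1).prod (gaussianReal 0 v)
  have hv' : (v : ℝ) ≤ 1 := by exact_mod_cast hv
  have hsq := integrable_sq_gaussianReal v
  have habs : Integrable (fun g : ℝ => |g|) (gaussianReal 0 v) :=
    ((memLp_id_gaussianReal 1).integrable (by simp)).abs
  have hm : MeasurableSet {x : ℝ | |x| ≤ 2.49} := measurableSet_le (by fun_prop) (by fun_prop)
  have hmeas : Measurable ({x : ℝ | |x| ≤ 2.49}.indicator (fun x => x ^ 2)) :=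
    (by fun_prop : Measurable fun x : ℝ => x ^ 2).indicator hm
  have hexp : (fun g : ℝ => 2.5 * ((20 * |g| + 0.01) / 19) * (|g| + 0.01))
      = fun g => 50 / 19 * g ^ 2 + (0.525 / 19 * |g| + 0.00025 / 19) := by
    ext g; rw [← sq_abs]; ring
  have hi1 : Integrable (fun g : ℝ => 2.5 * ((20 * |g| + 0.01) / 19) * (|g| + 0.01))
      (gaussianReal 0 v) := by
    rw [hexp]
    exact (hsq.const_mul _).add ((habs.const_mul _).add (integrable_const _))
  obtain ⟨hI, hle⟩ := integral_smallRatio_le v (u := fun g => 2.5 * ((20 * |g| + 0.01) / 19))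
    (fun g => by positivity) hi1
    (((habs.const_mul 20).add (integrable_const _)).div_const 19 |>.const_mul 2.5)
  have hval : ∫ g : ℝ, 2.5 * ((20 * |g| + 0.01) / 19) * (|g| + 0.01) ∂(gaussianReal 0 v) ≤ 2.67 := by
    have hadd : Integrable (fun g : ℝ => 0.525 / 19 * |g| + 0.00025 / 19) (gaussianReal 0 v) :=
      (habs.const_mul _).add (integrable_const _)
    rw [hexp, integral_add (hsq.const_mul _) hadd,
      integral_add (habs.const_mul _) (integrable_const _), integral_const_mul, integral_const_mul,
      integral_sq_gaussianReal]
    have := integral_abs_gaussianReal_le hv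
    simp only [integral_const, probReal_univ, smul_eq_mul, one_mul]
    linarith
  have hfst := integral_comp_map_inner_fst hh _ hmeas hμ
  have hi2 : Integrable (fun p : ℝ × ℝ => {x : ℝ | |x| ≤ 2.49}.indicator (fun x => x ^ 2)
      (ρ * p.1 + p.2)) μ := by
    refine Integrable.of_mem_Icc 0 (2.49 ^ 2) (by fun_prop) (ae_of_all _ fun p => ?_)
    by_cases hx : |ρ * p.1 + p.2| ≤ 2.49
    · rw [Set.indicator_of_mem (show _ ∈ {x : ℝ | |x| ≤ 2.49} from hx)]
      exact ⟨sq_nonneg _, sq_le_sq' (by linarith [neg_abs_le (ρ * p.1 + p.2)])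
        (by linarith [le_abs_self (ρ * p.1 + p.2)])⟩
    · rw [Set.indicator_of_notMem (show _ ∉ {x : ℝ | |x| ≤ 2.49} from hx)]
      norm_num
  have hm' : Measurable fun p : ℝ × ℝ => energyMinorant (ρ * p.1 + p.2) p.1 :=
    measurable_energyMinorant.comp (by fun_prop : Measurable fun p : ℝ × ℝ => (ρ * p.1 + p.2, p.1))
  have hmono : ∫ p : ℝ × ℝ, ({x : ℝ | |x| ≤ 2.49}.indicator (fun x => x ^ 2) (ρ * p.1 + p.2)
      - smallRatio.indicator (fun p => 2.5 * ((20 * |p.2| + 0.01) / 19)) p) ∂μ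
      ≤ ∫ p : ℝ × ℝ, energyMinorant (ρ * p.1 + p.2) p.1 ∂μ :=
    integral_mono (hi2.sub hI) (Integrable.of_mem_Icc 0 7 hm'.aemeasurable
      (ae_of_all _ fun p => ⟨energyMinorant_nonneg _ _, energyMinorant_le_seven _ _⟩))
      fun p => energyMinorant_ge hρ p.1 p.2
  rw [integral_sub hi2 hI, hfst] at hmono
  rw [integral_comp_map_inner (fun p => energyMinorant p.1 p.2) measurable_energyMinorant hμ]
  -- Numerically 0.89 - (0.8 / 19) · 2.67 > 0.775.
  have := integral_sq_indicator_ge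
  linarith

theorem integral_levelMinorant_ge {h w : E} (hh : ‖h‖ = 1) (hw : ‖w‖ = 1) :
    0.545 ≤ ∫ x, levelMinorant (inner ℝ x h) (inner ℝ x w) ∂(stdGaussian E) := by
  obtain ⟨ρ, hρ, v, hv, hμ⟩ := exists_map_inner_eq hh hw
  set μ := (gaussianReal 0 1).prod (gaussianReal 0 v)
  have habs : Integrable (fun g : ℝ => |g|) (gaussianReal 0 v) :=
    ((memLp_id_gaussianReal 1).integrable (by simp)).abs
  have hm : MeasurableSet {x : ℝ | |x| ≤ 0.51} := measurableSet_le (by fun_prop) (by fun_prop)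
  have hmeas : Measurable ({x : ℝ | |x| ≤ 0.51}.indicator (fun _ => (1 : ℝ))) :=
    measurable_const.indicator hm
  obtain ⟨hI, hle⟩ := integral_smallRatio_le v (u := fun _ => (1 : ℝ))
    (fun g => by positivity)
    ((habs.add (integrable_const _)).const_mul _) (integrable_const _)
  have hval : ∫ g : ℝ, 1 * (|g| + 0.01) ∂(gaussianReal 0 v) ≤ 1.01 := by
    rw [integral_const_mul, integral_add habs (integrable_const _)]
    have := integral_abs_gaussianReal_le hv
    simp only [integral_const, probReal_univ, smul_eq_mul, one_mul]
    linarith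
  have hfst := integral_comp_map_inner_fst hh _ hmeas hμ
  rw [integral_indicator_const _ hm, smul_eq_mul, mul_one] at hfst
  have hi2 : Integrable (fun p : ℝ × ℝ => {x : ℝ | |x| ≤ 0.51}.indicator (fun _ => (1 : ℝ))
      (ρ * p.1 + p.2)) μ := by
    refine Integrable.of_mem_Icc 0 1 (by fun_prop) (ae_of_all _ fun p => ?_)
    exact ⟨Set.indicator_nonneg (fun _ _ => by norm_num) _,
      Set.indicator_le_self' (fun _ _ => by norm_num) _⟩
  have hi3 : Integrable (fun p : ℝ × ℝ => 1 - {x : ℝ | |x| ≤ 0.51}.indicator (fun _ => (1 : ℝ))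
      (ρ * p.1 + p.2)) μ := (integrable_const 1).sub hi2
  have hm' : Measurable fun p : ℝ × ℝ => levelMinorant (ρ * p.1 + p.2) p.1 :=
    measurable_levelMinorant.comp (by fun_prop : Measurable fun p : ℝ × ℝ => (ρ * p.1 + p.2, p.1))
  have hmono : ∫ p : ℝ × ℝ, (1 - {x : ℝ | |x| ≤ 0.51}.indicator (fun _ => (1 : ℝ)) (ρ * p.1 + p.2)
      - smallRatio.indicator (fun _ => (1 : ℝ)) p) ∂μ
      ≤ ∫ p : ℝ × ℝ, levelMinorant (ρ * p.1 + p.2) p.1 ∂μ :=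
    integral_mono (hi3.sub hI) (Integrable.of_mem_Icc 0 1 hm'.aemeasurable
      (ae_of_all _ fun p => ⟨levelMinorant_nonneg _ _, levelMinorant_le_one _ _⟩))
      fun p => levelMinorant_ge hρ p.1 p.2
  rw [integral_sub hi3 hI, integral_sub (integrable_const 1) hi2,
    hfst] at hmono
  rw [integral_comp_map_inner (fun p => levelMinorant p.1 p.2) measurable_levelMinorant hμ]
  -- Numerically 1 - 0.8 · 0.51 - (0.8 / 19) · 1.01 > 0.545, safely above the 1/2 needed for the
  -- median.
  have := gaussianReal_abs_le 0.51 (by norm_num)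
  simp only [integral_const, probReal_univ, smul_eq_mul, one_mul] at hle hmono hval
  linarith

end Directions


/-! ### Concentration at fixed directions. -/

section Sample

variable {Ω : Type*} [MeasurableSpace Ω] {P : Measure Ω} [IsProbabilityMeasure P] {m n : ℕ}

/-- The rows of a Gaussian sample are independent standard Gaussian vectors. -/
theorem IsGaussianSample.hasLaw_iIndepFun {a : Fin m → Ω → EuclideanSpace ℝ (Fin n)}
    (ha : IsGaussianSample P a) :
    (∀ i, HasLaw (a i) (stdGaussian (EuclideanSpace ℝ (Fin n))) P) ∧ iIndepFun a P := by
  obtain ⟨hlaw, hind⟩ := ha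
  have hm : ∀ i j, AEMeasurable (fun ω => a i ω j) P := fun i j => (hlaw i j).aemeasurable
  have hR : ∀ i, AEMeasurable (fun ω j => a i ω j) P := fun i => aemeasurable_pi_iff.2 (hm i)
  have h1 : P.map (fun ω (ij : Fin m × Fin n) => a ij.1 ω ij.2)
      = Measure.infinitePi fun _ => gaussianReal 0 1 := by
    rw [iIndepFun.map_fun_eq_infinitePi_map₀'
      (X := fun (ij : Fin m × Fin n) ω => a ij.1 ω ij.2) (fun ij => hm ij.1 ij.2) hind]
    congr 1; ext1 ij
    exact (hlaw ij.1 ij.2).map_eq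
  have h2 : P.map (fun ω i j => a i ω j)
      = Measure.infinitePi fun _ : Fin m => Measure.infinitePi fun _ : Fin n => gaussianReal 0 1 := by
    -- Currying the product law of the entries exhibits it as a product over rows, which gives both
    -- the row laws and their independence.
    have h := Measure.infinitePi_map_curry (fun (_ : Fin m) (_ : Fin n) => gaussianReal 0 1)
    rw [← h1, AEMeasurable.map_map_of_aemeasurable (by fun_prop)
      (aemeasurable_pi_iff.2 fun ij : Fin m × Fin n => hm ij.1 ij.2)] at h
    exact h
  have h3 : ∀ i, P.map (fun ω j => a i ω j) = Measure.infinitePi fun _ : Fin n => gaussianReal 0 1 := by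
    intro i
    have h := congrArg (fun μ => Measure.map (fun f : Fin m → Fin n → ℝ => f i) μ) h2
    simp only at h
    rw [AEMeasurable.map_map_of_aemeasurable (measurable_pi_apply i).aemeasurable
      (aemeasurable_pi_iff.2 hR),
      Measure.infinitePi_map_eval] at h
    exact h
  have h4 : iIndepFun (fun i ω j => a i ω j) P := by
    rw [iIndepFun_iff_map_fun_eq_infinitePi_map₀' hR, h2]
    congr 1; ext1 i
    exact (h3 i).symm
  have hcomp : ∀ i, a i = (WithLp.toLp 2) ∘ fun ω j => a i ω j := fun i => rfl
  refine ⟨fun i => ⟨?_, ?_⟩, ?_⟩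
  · rw [hcomp i]
    exact (WithLp.measurable_toLp 2 (Fin n → ℝ)).comp_aemeasurable (hR i)
  · rw [hcomp i, ← AEMeasurable.map_map_of_aemeasurable (by fun_prop) (hR i), h3 i,
      Measure.infinitePi_eq_pi, map_pi_eq_stdGaussian]
  · exact h4.comp (fun _ => WithLp.toLp 2) fun _ => by fun_prop

/-- Hoeffding's lower tail bound for a bounded function of i.i.d. random vectors. -/
theorem measure_sum_comp_le {E : Type*} [MeasurableSpace E] {a : Fin m → Ω → E} {μ : Measure E}
    (hlaw : ∀ i, HasLaw (a i) μ P)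
    (hind : iIndepFun a P) {F : E → ℝ} (hF : Measurable F) {B c η : ℝ} (hη : 0 ≤ η)
    (hB : ∀ x, F x ∈ Set.Icc 0 B) (hc : c ≤ ∫ x, F x ∂μ) :
    P.real {ω | ∑ i, F (a i ω) ≤ m * (c - η)} ≤ Real.exp (-(2 * η ^ 2 / B ^ 2) * m) := by
  rcases Nat.eq_zero_or_pos m with rfl | hm
  · simp
  have hint : ∀ i, ∫ ω, F (a i ω) ∂P = ∫ x, F x ∂μ := fun i =>
    (hlaw i).integral_comp hF.aestronglyMeasurable
  have hsub : ∀ i, HasSubgaussianMGF (fun ω => (∫ x, F x ∂μ) - F (a i ω)) ((‖B - 0‖₊ / 2) ^ 2) P := by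
    intro i
    have h := (hasSubgaussianMGF_of_mem_Icc (μ := P) (X := fun ω => F (a i ω))
      (hF.comp_aemeasurable (hlaw i).aemeasurable) (ae_of_all _ fun ω => hB (a i ω))).neg
    rw [hint i] at h
    convert h using 1
    ext ω
    simp
  have h := HasSubgaussianMGF.measure_sum_ge_le_of_iIndepFun (s := Finset.univ)
    (hind.comp (fun _ x => (∫ x, F x ∂μ) - F x) fun _ => by fun_prop)
    (fun i _ => hsub i) (ε := m * η) (by positivity)
  refine (measureReal_mono ?_).trans (h.trans_eq ?_)
  · intro ω hω
    simp only [Set.mem_ofPred_eq, Function.comp_apply, Finset.sum_sub_distrib, Finset.sum_const,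
      Finset.card_univ, Fintype.card_fin, nsmul_eq_mul] at hω ⊢
    have : (m : ℝ) * c ≤ m * ∫ x, F x ∂μ := by gcongr
    linarith
  · congr 1
    have : (m : ℝ) ≠ 0 := by positivity
    simp only [sub_zero, Finset.sum_const, Finset.card_univ, Fintype.card_fin, nsmul_eq_mul,
      NNReal.coe_mul, NNReal.coe_natCast, NNReal.coe_pow, NNReal.coe_div, coe_nnnorm,
      NNReal.coe_ofNat, Real.norm_eq_abs, div_pow, sq_abs]
    -- At B = 0 both exponents are divisions by zero, hence 0, and the bound is the trivial 1.
    rcases eq_or_ne B 0 with rfl | hB0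
    · simp
    · field_simp

variable {E : Type*} [NormedAddCommGroup E] [InnerProductSpace ℝ E] [FiniteDimensional ℝ E]
  [MeasurableSpace E] [BorelSpace E] {a : Fin m → Ω → E}

/-- The chi-square upper tail bound. -/
theorem measure_sum_inner_sq_ge (hlaw : ∀ i, HasLaw (a i) (stdGaussian E) P)
    (hind : iIndepFun a P) {h : E} (hh : ‖h‖ = 1) :
    P.real {ω | 1.1 * m ≤ ∑ i, inner ℝ (a i ω) h ^ 2} ≤ Real.exp (-0.001 * m) := by
  have hm : ∀ i, AEMeasurable (fun ω => inner ℝ (a i ω) h) P := fun i =>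
    (by fun_prop : Measurable fun x : E => inner ℝ x h).comp_aemeasurable (hlaw i).aemeasurable
  have hmap : ∀ i, P.map (fun ω => inner ℝ (a i ω) h) = gaussianReal 0 1 := by
    intro i
    have h1 : gaussianReal 0 1 = gaussianReal 0 (‖h‖₊ ^ 2) := by
      congr 1; ext; simp [hh]
    rw [h1, ← map_inner_stdGaussian, ← (hlaw i).map_eq,
      AEMeasurable.map_map_of_aemeasurable (by fun_prop) (hlaw i).aemeasurable]
    rfl
  have hI : ∀ i, Integrable (fun ω => Real.exp (1 / 20 * inner ℝ (a i ω) h ^ 2)) P := by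
    intro i
    have := integrable_exp_sq_gaussianReal
    rw [← hmap i] at this
    exact this.comp_aemeasurable (hm i)
  have hM : ∀ i, mgf (fun ω => inner ℝ (a i ω) h ^ 2) P (1 / 20) = √(10 / 9) := by
    intro i
    rw [mgf, ← integral_exp_sq_gaussianReal, ← hmap i, integral_map (hm i) (by fun_prop)]
  have hind' : iIndepFun (fun i ω => inner ℝ (a i ω) h ^ 2) P :=
    hind.comp (fun _ x => inner ℝ x h ^ 2) fun _ => by fun_prop
  have hmeas' : ∀ i, AEMeasurable (fun ω => inner ℝ (a i ω) h ^ 2) P := fun i => (hm i).pow_const 2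
  have hsumI : Integrable (fun ω => Real.exp (1 / 20 * (∑ i, fun ω => inner ℝ (a i ω) h ^ 2) ω)) P := by
    -- A non-integrable exponential would have mgf 0 by convention, but independence makes it a
    -- product of positive factors.
    by_contra hcon
    have h0 : mgf (∑ i, fun ω => inner ℝ (a i ω) h ^ 2) P (1 / 20) = 0 := integral_undef hcon
    rw [hind'.mgf_sum₀ hmeas', Finset.prod_congr rfl fun i _ => hM i] at h0
    simp at h0
  have h := measure_ge_le_exp_mul_mgf (X := ∑ i, fun ω => inner ℝ (a i ω) h ^ 2) (μ := P)
    (t := 1 / 20) (1.1 * m) (by norm_num) hsumI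
  rw [hind'.mgf_sum₀ hmeas', Finset.prod_congr rfl fun i _ => hM i] at h
  simp only [Finset.sum_apply, Finset.prod_const, Finset.card_univ, Fintype.card_fin] at h
  refine h.trans ?_
  -- Chernoff at 1/20: the exponent per sample is -1.1/20 + 0.054 = -0.001.
  have hsq : √(10 / 9) ≤ Real.exp 0.054 := by
    rw [Real.sqrt_le_left (Real.exp_pos _).le, ← Real.exp_nat_mul]
    have := Real.quadratic_le_exp_of_nonneg (x := ((2 : ℕ) : ℝ) * 0.054) (by norm_num)
    refine le_trans ?_ this
    norm_num
  calc _ ≤ Real.exp (-(1 / 20) * (1.1 * m)) * Real.exp 0.054 ^ m := by gcongr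
    _ = Real.exp (-0.001 * m) := by
      rw [← Real.exp_nat_mul, ← Real.exp_add]
      congr 1
      ring

end Sample

/-! ### Nets of the sphere. -/

/-- A map to a finite type has a finite set of representatives of its fibres. -/
theorem exists_finset_representatives {α β : Type*} [Fintype β] (f : α → β) :
    ∃ S : Finset α, S.card ≤ Fintype.card β ∧ ∀ x, ∃ y ∈ S, f y = f x := by
  classical
  have hfin : (Set.range f).Finite := Set.toFinite _
  choose g hg using fun b : Set.range f => b.2
  refine ⟨Finset.univ.image g, ?_, fun x => ⟨g ⟨f x, x, rfl⟩, by simp, hg _⟩⟩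
  refine Finset.card_image_le.trans ?_
  rw [Finset.card_univ]
  exact Fintype.card_subtype_le _

/-- A net of the Euclidean unit sphere given by a grid. -/
theorem exists_sphere_net (n N : ℕ) (hN : 0 < N) :
    ∃ S : Finset (EuclideanSpace ℝ (Fin n)), S.card ≤ (2 * N + 1) ^ n ∧ (∀ v ∈ S, ‖v‖ = 1) ∧
      ∀ u : EuclideanSpace ℝ (Fin n), ‖u‖ = 1 → ∃ v ∈ S, ‖u - v‖ ≤ n / N := by
  classical
  have hN' : (0 : ℝ) < N := by exact_mod_cast hN
  have hcoord : ∀ (u : {u : EuclideanSpace ℝ (Fin n) // ‖u‖ = 1}) (j : Fin n),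
      ⌊(N : ℝ) * u.1 j⌋ ∈ Finset.Icc (-(N : ℤ)) N := by
    intro u j
    have h1 : |u.1 j| ≤ 1 := by
      have := PiLp.norm_apply_le u.1 j
      rwa [u.2, Real.norm_eq_abs] at this
    rw [abs_le] at h1
    rw [Finset.mem_Icc, Int.le_floor, ← Int.cast_le (R := ℝ)]
    refine ⟨by push_cast; nlinarith, (Int.floor_le _).trans (by push_cast; nlinarith)⟩
  -- Taking one unit vector from each occupied grid cell keeps the net on the sphere, with no
  -- renormalisation.
  obtain ⟨S, hS, hrep⟩ := exists_finset_representatives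
    (fun (u : {u : EuclideanSpace ℝ (Fin n) // ‖u‖ = 1}) (j : Fin n) =>
      (⟨⌊(N : ℝ) * u.1 j⌋, hcoord u j⟩ : {k : ℤ // k ∈ Finset.Icc (-(N : ℤ)) N}))
  refine ⟨S.image Subtype.val, ?_, ?_, ?_⟩
  · refine Finset.card_image_le.trans (hS.trans_eq ?_)
    simp only [Fintype.card_pi, Fintype.card_coe, Int.card_Icc, Finset.prod_const,
      Finset.card_univ, Fintype.card_fin]
    congr 1
    omega
  · simp only [Finset.mem_image, Subtype.exists]
    rintro v ⟨u, hu, -, rfl⟩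
    exact hu
  · intro u hu
    obtain ⟨v, hv, hvu⟩ := hrep ⟨u, hu⟩
    refine ⟨v.1, Finset.mem_image_of_mem _ hv, ?_⟩
    have hj : ∀ j, (u j - v.1 j) ^ 2 ≤ (1 / N : ℝ) ^ 2 := by
      intro j
      have h1 := congrArg Subtype.val (congrFun hvu j)
      simp only at h1
      have h2 := Int.abs_sub_lt_one_of_floor_eq_floor h1
      rw [← mul_sub, abs_mul, abs_of_pos hN'] at h2
      rw [sq_le_sq, abs_of_pos (by positivity : (0 : ℝ) < 1 / N), le_div_iff₀ hN', abs_sub_comm]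
      linarith
    have h3 : ‖u - v.1‖ ^ 2 ≤ (n / N : ℝ) ^ 2 := by
      rw [EuclideanSpace.real_norm_sq_eq]
      calc ∑ j, (u - v.1) j ^ 2 ≤ ∑ _j : Fin n, (1 / N : ℝ) ^ 2 :=
            Finset.sum_le_sum fun j _ => by simpa using hj j
        _ = n * (1 / N : ℝ) ^ 2 := by simp
        _ ≤ (n : ℝ) ^ 2 * (1 / N : ℝ) ^ 2 := by
            gcongr
            exact_mod_cast Nat.le_self_pow two_ne_zero n
        _ = (n / N : ℝ) ^ 2 := by ring
    exact (sq_le_sq₀ (norm_nonneg _) (by positivity)).1 h3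


/-! ### From the net to all directions. -/

/-- The uniform properties of the measurement vectors behind the regularity condition. -/
structure UniformBounds {m n : ℕ} (a : Fin m → EuclideanSpace ℝ (Fin n)) : Prop where
  sum_sq_le : ∀ h : EuclideanSpace ℝ (Fin n), ‖h‖ = 1 → ∑ i, inner ℝ (a i) h ^ 2 ≤ 1.12 * m
  le_sum_energy : ∀ h w : EuclideanSpace ℝ (Fin n), ‖h‖ = 1 → ‖w‖ = 1 →
    0.76 * m ≤ ∑ i, energyMinorant (inner ℝ (a i) h) (inner ℝ (a i) w)
  lt_sum_level : ∀ h w : EuclideanSpace ℝ (Fin n), ‖h‖ = 1 → ‖w‖ = 1 →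
    (m : ℝ) / 2 < ∑ i, levelMinorant (inner ℝ (a i) h) (inner ℝ (a i) w)

theorem sum_norm_sq_eq {m n : ℕ} (a : Fin m → EuclideanSpace ℝ (Fin n)) :
    ∑ i, ‖a i‖ ^ 2 = ∑ j, ∑ i, inner ℝ (a i) (EuclideanSpace.single j (1 : ℝ)) ^ 2 := by
  rw [Finset.sum_comm]
  refine Finset.sum_congr rfl fun i _ => ?_
  rw [EuclideanSpace.real_norm_sq_eq]
  simp [EuclideanSpace.inner_single_right]

/-- Lipschitz functions of two inner products vary little between nearby directions. -/
theorem abs_sum_sub_sum_le {m n : ℕ} {a : Fin m → EuclideanSpace ℝ (Fin n)} {F : ℝ → ℝ → ℝ} {C δ : ℝ}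
    (hC : 0 ≤ C) (hF : ∀ s t s' t', |F s t - F s' t'| ≤ C * (|s - s'| + |t - t'|))
    {h w h' w' : EuclideanSpace ℝ (Fin n)} (hh : ‖h - h'‖ ≤ δ) (hw : ‖w - w'‖ ≤ δ) :
    |∑ i, F (inner ℝ (a i) h) (inner ℝ (a i) w) - ∑ i, F (inner ℝ (a i) h') (inner ℝ (a i) w')|
      ≤ C * δ * (m + ∑ i, ‖a i‖ ^ 2) := by
  have hin : ∀ i, ∀ u v : EuclideanSpace ℝ (Fin n), ‖u - v‖ ≤ δ →
      |inner ℝ (a i) u - inner ℝ (a i) v| ≤ ‖a i‖ * δ := by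
    intro i u v huv
    rw [← inner_sub_right]
    exact (abs_real_inner_le_norm _ _).trans (by gcongr)
  have hδ : 0 ≤ δ := (norm_nonneg _).trans hh
  rw [← Finset.sum_sub_distrib]
  calc _ ≤ ∑ i, |F (inner ℝ (a i) h) (inner ℝ (a i) w)
        - F (inner ℝ (a i) h') (inner ℝ (a i) w')| := Finset.abs_sum_le_sum_abs _ _
    _ ≤ ∑ i, C * δ * (1 + ‖a i‖ ^ 2) := by
        refine Finset.sum_le_sum fun i _ => (hF _ _ _ _).trans ?_
        calc _ ≤ C * (‖a i‖ * δ + ‖a i‖ * δ) :=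
              mul_le_mul_of_nonneg_left (add_le_add (hin i _ _ hh) (hin i _ _ hw)) hC
          _ = C * δ * (2 * ‖a i‖) := by ring
          _ ≤ _ := by
              gcongr
              nlinarith [sq_nonneg (‖a i‖ - 1)]
    _ = _ := by
        rw [← Finset.mul_sum, Finset.sum_add_distrib]; simp

/-- Membership of the standard basis in S bounds Σ‖aᵢ‖² by 1.1mn, so a mesh of order 1/n moves each
normalised sum by at most a constant. That constant, at most 0.005, fits the gaps 0.765 - 0.76 and
0.525 - 0.5. -/
theorem uniformBounds_of_net {m n : ℕ} (hm : 0 < m) (hn : 0 < n)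
    {a : Fin m → EuclideanSpace ℝ (Fin n)}
    {S : Finset (EuclideanSpace ℝ (Fin n))} (hS1 : ∀ v ∈ S, ‖v‖ = 1)
    (hSb : ∀ j : Fin n, EuclideanSpace.single j (1 : ℝ) ∈ S)
    (hSnet : ∀ u : EuclideanSpace ℝ (Fin n), ‖u‖ = 1 → ∃ v ∈ S, ‖u - v‖ ≤ 1e-7 / n)
    (h1 : ∀ h ∈ S, ∑ i, inner ℝ (a i) h ^ 2 ≤ 1.1 * m)
    (h2 : ∀ h ∈ S, ∀ w ∈ S,
      m * (0.775 - 0.01) ≤ ∑ i, energyMinorant (inner ℝ (a i) h) (inner ℝ (a i) w))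
    (h3 : ∀ h ∈ S, ∀ w ∈ S,
      m * (0.545 - 0.02) ≤ ∑ i, levelMinorant (inner ℝ (a i) h) (inner ℝ (a i) w)) :
    UniformBounds a := by
  have hm' : (0 : ℝ) < m := by exact_mod_cast hm
  have hn' : (1 : ℝ) ≤ n := by exact_mod_cast hn
  have hT : ∑ i, ‖a i‖ ^ 2 ≤ 1.1 * m * n := by
    rw [sum_norm_sq_eq]
    calc _ ≤ ∑ _j : Fin n, (1.1 * m : ℝ) := Finset.sum_le_sum fun j _ => h1 _ (hSb j)
      _ = 1.1 * m * n := by simp; ring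
  have hT0 : 0 ≤ ∑ i, ‖a i‖ ^ 2 := by positivity
  have herr : 12500 * (1e-7 / (n : ℝ)) * ((m : ℝ) + ∑ i, ‖a i‖ ^ 2) ≤ 0.005 * (m : ℝ) := by
    calc _ ≤ 12500 * (1e-7 / (n : ℝ)) * ((m : ℝ) * n + 1.1 * m * n) := by
          gcongr
          nlinarith
      _ = 12500 * 1e-7 * 2.1 * (m : ℝ) := by field_simp; ring
      _ ≤ 0.005 * (m : ℝ) := by nlinarith
  refine ⟨fun h hh => ?_, fun h w hh hw => ?_, fun h w hh hw => ?_⟩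
  · obtain ⟨v, hv, hvh⟩ := hSnet h hh
    have h4 : ∑ i, inner ℝ (a i) h ^ 2 ≤ ∑ i, (inner ℝ (a i) v ^ 2 + 2 * (1e-7 / n) * ‖a i‖ ^ 2) := by
      refine Finset.sum_le_sum fun i _ => ?_
      have e1 : |inner ℝ (a i) h - inner ℝ (a i) v| ≤ ‖a i‖ * (1e-7 / n) := by
        rw [← inner_sub_right]
        exact (abs_real_inner_le_norm _ _).trans (by gcongr)
      have e2 : |inner ℝ (a i) h + inner ℝ (a i) v| ≤ ‖a i‖ * 2 := by
        rw [← inner_add_right]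
        refine (abs_real_inner_le_norm _ _).trans ?_
        gcongr
        exact (norm_add_le _ _).trans (by rw [hh, hS1 v hv]; norm_num)
      have e3 : inner ℝ (a i) h ^ 2 - inner ℝ (a i) v ^ 2 ≤ (‖a i‖ * 2) * (‖a i‖ * (1e-7 / n)) := by
        rw [sq_sub_sq]
        refine (le_abs_self _).trans ?_
        rw [abs_mul]
        gcongr
      linarith
    rw [Finset.sum_add_distrib, ← Finset.mul_sum] at h4
    have h5 : 2 * (1e-7 / n) * ∑ i, ‖a i‖ ^ 2 ≤ 2 * (1e-7 / n) * (1.1 * m * n) := by gcongr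
    have h6 : 2 * (1e-7 / (n : ℝ)) * (1.1 * m * n) = 2 * 1e-7 * 1.1 * m := by field_simp
    have := h1 v hv
    linarith
  · obtain ⟨v, hv, hvh⟩ := hSnet h hh
    obtain ⟨u, hu, huw⟩ := hSnet w hw
    have h4 := abs_sum_sub_sum_le (a := a) (by norm_num) abs_energyMinorant_sub_le hvh huw
    have := h2 v hv u hu
    rw [abs_le] at h4
    linarith [h4.1]
  · obtain ⟨v, hv, hvh⟩ := hSnet h hh
    obtain ⟨u, hu, huw⟩ := hSnet w hw
    have h4 := abs_sum_sub_sum_le (a := a) (by norm_num) abs_levelMinorant_sub_le hvh huw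
    have := h3 v hv u hu
    rw [abs_le] at h4
    linarith [h4.1]

/-! ### The deterministic regularity argument. -/

theorem le_sampleMedian {m : ℕ} (X : Fin m → ℝ) {b : ℝ}
    (hb : (m : ℝ) / 2 < ((Finset.univ.filter fun i => b ≤ X i).card : ℝ)) :
    b ≤ sampleMedian X := by
  have hm0 : 0 < m := by
    rcases Nat.eq_zero_or_pos m with rfl | h
    · simp at hb
    · exact h
  have hm' : (0 : ℝ) < m := by exact_mod_cast hm0
  refine le_csInf ?_ fun t ht => ?_
  -- Nonemptiness matters, since `sInf ∅` would be 0.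
  · refine ⟨∑ i, |X i|, ?_⟩
    have : (Finset.univ.filter fun i => X i ≤ ∑ j, |X j|) = Finset.univ :=
      Finset.filter_true_of_mem fun i _ => (le_abs_self _).trans
        (Finset.single_le_sum (f := fun j => |X j|) (fun j _ => abs_nonneg _) (Finset.mem_univ i))
    simp only [Set.mem_ofPred_eq, empiricalCDF]
    rw [this, Finset.card_univ, Fintype.card_fin, div_self hm'.ne']
    norm_num
  · by_contra! hlt
    simp only [Set.mem_ofPred_eq, empiricalCDF] at ht
    rw [le_div_iff₀ hm'] at ht
    have hdisj : Disjoint (Finset.univ.filter fun i => X i ≤ t)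
        (Finset.univ.filter fun i => b ≤ X i) := by
      rw [Finset.disjoint_filter]
      intro i _ h1 h2
      linarith
    have hcard := Finset.card_le_univ (Finset.disjUnion _ _ hdisj)
    rw [Finset.card_disjUnion, Fintype.card_fin] at hcard
    have : (((Finset.univ.filter fun i => X i ≤ t).card : ℝ)
      + (Finset.univ.filter fun i => b ≤ X i).card) ≤ m := by exact_mod_cast hcard
    linarith

theorem abs_abs_sub_sub_abs_eq {u p : ℝ} (h : |p| ≤ |u|) : |(|u - p| - |u|)| = |p| := by
  rcases le_total 0 u with hu | hu
  · rw [abs_of_nonneg hu] at h ⊢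
    rw [abs_of_nonneg (by linarith [le_abs_self p] : 0 ≤ u - p), sub_sub_cancel_left, abs_neg]
  · rw [abs_of_nonpos hu] at h ⊢
    rw [abs_of_nonpos (by linarith [neg_abs_le p] : u - p ≤ 0)]
    congr 1; ring

theorem reshaped_term_eq {u p : ℝ} (h : |p| ≤ |u|) : (u - |u - p| * (u / |u|)) * p = p ^ 2 := by
  rcases lt_trichotomy u 0 with hu | rfl | hu
  · rw [abs_of_neg hu] at h ⊢
    rw [abs_of_nonpos (by linarith [neg_abs_le p] : u - p ≤ 0)]
    have := hu.ne
    field_simp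
    ring
  · simp only [abs_zero, abs_nonpos_iff] at h
    simp [h]
  · rw [abs_of_pos hu] at h ⊢
    rw [abs_of_nonneg (by linarith [le_abs_self p] : 0 ≤ u - p)]
    have := hu.ne'
    field_simp
    ring

/-- If u and u - p have opposite signs, the product is 2up - p², and then p has the sign of u, so up
≥ 0. -/
theorem neg_sq_le_reshaped_term (u p : ℝ) : -p ^ 2 ≤ (u - |u - p| * (u / |u|)) * p := by
  rcases lt_trichotomy u 0 with hu | rfl | hu
  · have h1 : u / |u| = -1 := by rw [abs_of_neg hu, div_neg, div_self hu.ne]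
    rw [h1]
    rcases le_total 0 (u - p) with h | h
    · rw [abs_of_nonneg h]; nlinarith
    · rw [abs_of_nonpos h]; nlinarith [sq_nonneg p]
  · simp; positivity
  · have h1 : u / |u| = 1 := by rw [abs_of_pos hu, div_self hu.ne']
    rw [h1]
    rcases le_total 0 (u - p) with h | h
    · rw [abs_of_nonneg h]; nlinarith [sq_nonneg p]
    · rw [abs_of_nonpos h]; nlinarith

/-- On the uniform bounds, the truncated gradient satisfies the regularity condition. -/
theorem UniformBounds.le_inner_truncatedGradient {m n : ℕ} {a : Fin m → EuclideanSpace ℝ (Fin n)}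
    (hm : 0 < m) (ha : UniformBounds a) {x z : EuclideanSpace ℝ (Fin n)} (hz : z ≠ 0)
    (hxz : ‖z - x‖ / ‖z‖ ≤ 1 / 20) :
    0.38 * ‖z - x‖ ^ 2 ≤ inner ℝ (truncatedGradient 5 a (noiseFree a x) z) (z - x) := by
  have hm' : (0 : ℝ) < m := by exact_mod_cast hm
  have hz' : 0 < ‖z‖ := norm_pos_iff.2 hz
  rcases eq_or_ne (z - x) 0 with h0 | h0
  · simp [h0]
  set r := ‖z - x‖ with hr
  have hr0 : 0 < r := norm_pos_iff.2 h0
  rw [div_le_iff₀ hz'] at hxz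
  set d := r⁻¹ • (z - x) with hd
  set w := ‖z‖⁻¹ • z with hw
  have hd1 : ‖d‖ = 1 := by rw [hd, norm_smul, norm_inv, norm_norm, inv_mul_cancel₀ hr0.ne']
  have hw1 : ‖w‖ = 1 := by rw [hw, norm_smul, norm_inv, norm_norm, inv_mul_cancel₀ hz'.ne']
  set s : Fin m → ℝ := fun i => inner ℝ (a i) d with hs
  set t : Fin m → ℝ := fun i => inner ℝ (a i) w with ht
  have hp : ∀ i, inner ℝ (a i) (z - x) = r * s i := by
    intro i; simp only [hs, hd, inner_smul_right]; field_simp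
  have hu : ∀ i, inner ℝ (a i) z = ‖z‖ * t i := by
    intro i; simp only [ht, hw, inner_smul_right]; field_simp
  have hy : ∀ i, √(noiseFree a x i) = |‖z‖ * t i - r * s i| := by
    intro i
    rw [noiseFree, Real.sqrt_sq (abs_nonneg _), ← hp, ← hu, inner_sub_right, sub_sub_cancel]
  have hres : ∀ i, |s i| ≤ 20 * |t i| → |r * s i| ≤ |‖z‖ * t i| := by
    intro i hi
    rw [abs_mul, abs_mul, abs_of_pos hr0, abs_of_pos hz']
    calc r * |s i| ≤ r * (20 * |t i|) := by gcongr
      _ = (20 * r) * |t i| := by ring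
      _ ≤ ‖z‖ * |t i| := by gcongr; linarith
  have hresid : ∀ i, |s i| ≤ 20 * |t i| → residual a (noiseFree a x) z i = r * |s i| := by
    intro i hi
    rw [residual, hy, hu, abs_abs_sub_sub_abs_eq (hres i hi), abs_mul, abs_of_pos hr0]
  have hmed : r * (1 / 2) ≤ sampleMedian (residual a (noiseFree a x) z) := by
    refine le_sampleMedian _ ((ha.lt_sum_level d w hd1 hw1).trans_le ?_)
    rw [Finset.card_filter]
    push_cast
    refine Finset.sum_le_sum fun i _ => ?_
    by_cases h : 1 / 2 < |s i| ∧ |s i| ≤ 20 * |t i|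
    · rw [if_pos]
      · exact levelMinorant_le_one _ _
      · rw [hresid i h.2]
        gcongr
        exact h.1.le
    · rw [levelMinorant_eq_zero h]
      split_ifs <;> norm_num
  have hterm : ∀ i, r ^ 2 * (2 * energyMinorant (s i) (t i) - s i ^ 2) ≤
      inner ℝ (if residual a (noiseFree a x) z i
          ≤ 5 * sampleMedian (residual a (noiseFree a x) z) then
        (inner ℝ (a i) z - √(noiseFree a x i) * (inner ℝ (a i) z / |inner ℝ (a i) z|)) • a i
        else 0) (z - x) := by
    intro i
    rw [apply_ite (fun v => inner ℝ v (z - x)), inner_smul_left, inner_zero_left, hp, hy, hu,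
      RCLike.conj_to_real]
    have hE := energyMinorant_le_sq (s i) (t i)
    by_cases h : |s i| ≤ 2.5 ∧ |s i| ≤ 20 * |t i|
    · rw [if_pos, reshaped_term_eq (hres i h.2)]
      · nlinarith [sq_nonneg r]
      · rw [hresid i h.2]
        nlinarith [h.1]
    · rw [energyMinorant_eq_zero h]
      have := neg_sq_le_reshaped_term (‖z‖ * t i) (r * s i)
      split_ifs
      · nlinarith
      · nlinarith [sq_nonneg (r * s i)]
  rw [truncatedGradient, inner_smul_left, sum_inner, RCLike.conj_to_real]
  have hsum := Finset.sum_le_sum fun i (_ : i ∈ Finset.univ) => hterm i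
  rw [← Finset.mul_sum, Finset.sum_sub_distrib, ← Finset.mul_sum] at hsum
  have e1 := ha.sum_sq_le d hd1
  have e2 := ha.le_sum_energy d w hd1 hw1
  rw [one_div_mul_eq_div, le_div_iff₀ hm']
  refine le_trans ?_ hsum
  calc 0.38 * r ^ 2 * m = r ^ 2 * (0.38 * m) := by ring
    _ ≤ _ := by
      gcongr
      linarith

/-- The second entry of the minimum is a Gaussian tail beyond a nonnegative threshold. -/
theorem half_le_zeta₁ {α r : ℝ} (hα : 0 ≤ α) (hr : 0 ≤ r) : 1 / 2 ≤ zeta₁ α r := by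
  have h : ∫ ξ : ℝ, {ξ : ℝ | 0.5 * √1.01 * α * r ≤ ξ}.indicator (fun _ => (1 : ℝ)) ξ
      ∂(gaussianReal 0 1) ≤ 1 / 2 := by
    have hset : {ξ : ℝ | 0.5 * √1.01 * α * r ≤ ξ} = Set.Ici (0.5 * √1.01 * α * r) := rfl
    rw [hset, integral_indicator_const _ measurableSet_Ici, smul_eq_mul, mul_one]
    refine (measureReal_mono fun ξ hξ => ?_).trans gaussianReal_Ici_zero_le
    have h0 : 0 ≤ 0.5 * √1.01 * α * r := by positivity
    exact h0.trans hξ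
  exact (fun y hy => by linarith : ∀ y : ℝ, y ≤ 1 / 2 → 1 / 2 ≤ 1 - y) _ ((min_le_right _ _).trans h)

theorem zeta₂_nonneg (α : ℝ) : 0 ≤ zeta₂ α :=
  integral_nonneg fun _ => Set.indicator_nonneg (fun _ _ => sq_nonneg _) _


/-! ### Union bound over the net. -/

theorem measure_not_uniformBounds_le_card {Ω : Type*} [MeasurableSpace Ω] {P : Measure Ω}
    [IsProbabilityMeasure P] {m n : ℕ} (hm : 0 < m) (hn : 0 < n)
    {a : Fin m → Ω → EuclideanSpace ℝ (Fin n)} (ha : IsGaussianSample P a)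
    {S : Finset (EuclideanSpace ℝ (Fin n))} (hS1 : ∀ v ∈ S, ‖v‖ = 1)
    (hSb : ∀ j : Fin n, EuclideanSpace.single j (1 : ℝ) ∈ S)
    (hSnet : ∀ u : EuclideanSpace ℝ (Fin n), ‖u‖ = 1 → ∃ v ∈ S, ‖u - v‖ ≤ 1e-7 / n) :
    P.real {ω | ¬ UniformBounds fun i => a i ω} ≤ 3 * (S.card : ℝ) ^ 2 * Real.exp (-4e-6 * m) := by
  classical
  obtain ⟨hlaw, hind⟩ := ha.hasLaw_iIndepFun
  set B1 : EuclideanSpace ℝ (Fin n) → Set Ω := fun h =>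
    {ω | 1.1 * m ≤ ∑ i, inner ℝ (a i ω) h ^ 2}
  set B2 : EuclideanSpace ℝ (Fin n) × EuclideanSpace ℝ (Fin n) → Set Ω := fun p =>
    {ω | ∑ i, energyMinorant (inner ℝ (a i ω) p.1) (inner ℝ (a i ω) p.2) ≤ m * (0.775 - 0.01)}
  set B3 : EuclideanSpace ℝ (Fin n) × EuclideanSpace ℝ (Fin n) → Set Ω := fun p =>
    {ω | ∑ i, levelMinorant (inner ℝ (a i ω) p.1) (inner ℝ (a i ω) p.2) ≤ m * (0.545 - 0.02)}
  have hsub : {ω | ¬ UniformBounds fun i => a i ω} ⊆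
      (⋃ h ∈ S, B1 h) ∪ ((⋃ p ∈ S ×ˢ S, B2 p) ∪ (⋃ p ∈ S ×ˢ S, B3 p)) := by
    intro ω hω
    by_contra hcon
    simp only [Set.mem_union, Set.mem_iUnion, not_or, not_exists, Finset.mem_product] at hcon
    obtain ⟨c1, c2, c3⟩ := hcon
    exact hω (uniformBounds_of_net hm hn hS1 hSb hSnet
      (fun h hh => (not_le.1 (c1 h hh)).le)
      (fun h hh w hw => (not_le.1 (c2 (h, w) ⟨hh, hw⟩)).le)
      (fun h hh w hw => (not_le.1 (c3 (h, w) ⟨hh, hw⟩)).le))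
  -- The weakest of the three rates is Hoeffding for the energy, 2 · 0.01² / 7² > 4e-6.
  have hmono : ∀ c : ℝ, 4e-6 ≤ c → Real.exp (-c * m) ≤ Real.exp (-4e-6 * m) := by
    intro c hc
    gcongr
  have hb1 : ∀ h ∈ S, P.real (B1 h) ≤ Real.exp (-4e-6 * m) := fun h hh =>
    (measure_sum_inner_sq_ge hlaw hind (hS1 h hh)).trans (hmono _ (by norm_num))
  have hb2 : ∀ p ∈ S ×ˢ S, P.real (B2 p) ≤ Real.exp (-4e-6 * m) := fun p hp => by
    rw [Finset.mem_product] at hp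
    exact (measure_sum_comp_le hlaw hind
      (F := fun x => energyMinorant (inner ℝ x p.1) (inner ℝ x p.2))
      (measurable_energyMinorant.comp
        (by fun_prop : Measurable fun x => (inner ℝ x p.1, inner ℝ x p.2))) (by norm_num)
      (fun x => ⟨energyMinorant_nonneg _ _, energyMinorant_le_seven _ _⟩)
      (integral_energyMinorant_ge (hS1 _ hp.1) (hS1 _ hp.2))).trans (hmono _ (by norm_num))
  have hb3 : ∀ p ∈ S ×ˢ S, P.real (B3 p) ≤ Real.exp (-4e-6 * m) := fun p hp => by
    rw [Finset.mem_product] at hp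
    exact (measure_sum_comp_le hlaw hind
      (F := fun x => levelMinorant (inner ℝ x p.1) (inner ℝ x p.2))
      (measurable_levelMinorant.comp
        (by fun_prop : Measurable fun x => (inner ℝ x p.1, inner ℝ x p.2))) (by norm_num)
      (fun x => ⟨levelMinorant_nonneg _ _, levelMinorant_le_one _ _⟩)
      (integral_levelMinorant_ge (hS1 _ hp.1) (hS1 _ hp.2))).trans (hmono _ (by norm_num))
  have hunion : ∀ {ι : Type _} (T : Finset ι) (B : ι → Set Ω),
      (∀ p ∈ T, P.real (B p) ≤ Real.exp (-4e-6 * m)) →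
      P.real (⋃ p ∈ T, B p) ≤ T.card * Real.exp (-4e-6 * m) := by
    intro ι T B hB
    refine (measureReal_biUnion_finset_le T B).trans ((Finset.sum_le_sum hB).trans_eq ?_)
    simp
  have hpos : (S.card : ℝ) ≤ (S.card : ℝ) ^ 2 := by
    exact_mod_cast Nat.le_self_pow two_ne_zero S.card
  calc _ ≤ _ := measureReal_mono hsub
    _ ≤ _ := measureReal_union_le _ _
    _ ≤ S.card * Real.exp (-4e-6 * m) + ((S ×ˢ S).card * Real.exp (-4e-6 * m)
        + (S ×ˢ S).card * Real.exp (-4e-6 * m)) :=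
      add_le_add (hunion _ _ hb1)
        ((measureReal_union_le _ _).trans (add_le_add (hunion _ _ hb2) (hunion _ _ hb3)))
    _ ≤ (S.card : ℝ) ^ 2 * Real.exp (-4e-6 * m) + ((S.card : ℝ) ^ 2 * Real.exp (-4e-6 * m)
        + (S.card : ℝ) ^ 2 * Real.exp (-4e-6 * m)) := by
      rw [Finset.card_product]
      push_cast
      rw [← sq]
      gcongr
    _ = _ := by ring

/-- A net of the sphere containing the standard basis, of size `exp (O(n log n))`. -/
theorem exists_sphere_net_basis {n : ℕ} (hn : 0 < n) :
    ∃ S : Finset (EuclideanSpace ℝ (Fin n)), (S.card : ℝ) ≤ 2 * (2 ^ 25 * (n : ℝ) ^ 2) ^ n ∧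
      (∀ v ∈ S, ‖v‖ = 1) ∧ (∀ j : Fin n, EuclideanSpace.single j (1 : ℝ) ∈ S) ∧
      ∀ u : EuclideanSpace ℝ (Fin n), ‖u‖ = 1 → ∃ v ∈ S, ‖u - v‖ ≤ 1e-7 / n := by
  classical
  have hn' : (1 : ℝ) ≤ n := by exact_mod_cast hn
  -- With N = 10⁷n² the mesh n / N is 1e-7 / n.
  obtain ⟨S, hcard, hS1, hS⟩ := exists_sphere_net n (10 ^ 7 * n ^ 2) (by positivity)
  refine ⟨S ∪ Finset.univ.image fun j => EuclideanSpace.single j (1 : ℝ), ?_, ?_, ?_, ?_⟩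
  · have h1 : (2 * (10 ^ 7 * n ^ 2) + 1) ^ n ≤ (2 ^ 25 * n ^ 2) ^ n := by
      gcongr
      nlinarith
    have h2 : n ≤ (2 ^ 25 * n ^ 2) ^ n := by
      calc n ≤ 2 ^ n := Nat.lt_two_pow_self.le
        _ ≤ _ := by gcongr; nlinarith
    have h3 : (S ∪ Finset.univ.image fun j : Fin n => EuclideanSpace.single j (1 : ℝ)).card
        ≤ 2 * (2 ^ 25 * n ^ 2) ^ n := by
      refine (Finset.card_union_le _ _).trans ?_
      have h4 := Finset.card_image_le (s := (Finset.univ : Finset (Fin n)))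
        (f := fun j => EuclideanSpace.single j (1 : ℝ))
      rw [Finset.card_univ, Fintype.card_fin] at h4
      rw [two_mul]
      exact add_le_add (hcard.trans h1) (h4.trans h2)
    exact_mod_cast h3
  · intro v hv
    rcases Finset.mem_union.1 hv with hv | hv
    · exact hS1 v hv
    · obtain ⟨j, -, rfl⟩ := Finset.mem_image.1 hv
      simp
  · exact fun j => Finset.mem_union_right _ (Finset.mem_image_of_mem _ (Finset.mem_univ j))
  · intro u hu
    obtain ⟨v, hv, hvu⟩ := hS u hu
    refine ⟨v, Finset.mem_union_left _ hv, hvu.trans_eq ?_⟩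
    push_cast
    field_simp
    norm_num

/-- For n ≥ 2 the constant 2²⁵ is absorbed into n²⁵, giving exponent 2(25 + 2) = 54. For n = 1 the
logarithm vanishes and the factor 2⁵⁰ is needed. -/
theorem net_size_sq_le {n : ℕ} (hn : 0 < n) :
    ((2 ^ 25 * (n : ℝ) ^ 2) ^ n) ^ 2 ≤ 2 ^ 50 * Real.exp (54 * (n * Real.log n)) := by
  have hn' : (0 : ℝ) < n := by exact_mod_cast hn
  rcases Nat.lt_or_ge 1 n with h | h
  · have h2 : (2 : ℝ) ≤ n := by exact_mod_cast h
    have hexp : Real.exp (54 * (n * Real.log n)) = ((n : ℝ) ^ n) ^ 54 := by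
      rw [show (54 : ℝ) * (n * Real.log n) = ((54 : ℕ) : ℝ) * (n * Real.log n) by norm_num,
        Real.exp_nat_mul, Real.exp_nat_mul, Real.exp_log hn']
    rw [hexp]
    calc ((2 ^ 25 * (n : ℝ) ^ 2) ^ n) ^ 2 ≤ (((n : ℝ) ^ 25 * (n : ℝ) ^ 2) ^ n) ^ 2 := by gcongr
      _ = ((n : ℝ) ^ n) ^ 54 := by rw [← pow_add, ← pow_mul, ← pow_mul, ← pow_mul]; ring_nf
      _ ≤ 2 ^ 50 * ((n : ℝ) ^ n) ^ 54 := le_mul_of_one_le_left (by positivity) (by norm_num)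
  · obtain rfl : n = 1 := by omega
    norm_num

theorem measure_not_uniformBounds_le {Ω : Type*} [MeasurableSpace Ω] {P : Measure Ω}
    [IsProbabilityMeasure P] {m n : ℕ} (hm : 0 < m) (hn : 0 < n)
    (hmn : 108 / 4e-6 * n * Real.log n < m)
    {a : Fin m → Ω → EuclideanSpace ℝ (Fin n)} (ha : IsGaussianSample P a) :
    P.real {ω | ¬ UniformBounds fun i => a i ω} ≤ 12 * 2 ^ 50 * Real.exp (-2e-6 * m) := by
  obtain ⟨S, hcard, hS1, hSb, hSnet⟩ := exists_sphere_net_basis hn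
  refine (measure_not_uniformBounds_le_card hm hn ha hS1 hSb hSnet).trans ?_
  calc 3 * (S.card : ℝ) ^ 2 * Real.exp (-4e-6 * m)
      ≤ 3 * (2 * (2 ^ 25 * (n : ℝ) ^ 2) ^ n) ^ 2 * Real.exp (-4e-6 * m) := by gcongr
    _ = 12 * ((2 ^ 25 * (n : ℝ) ^ 2) ^ n) ^ 2 * Real.exp (-4e-6 * m) := by ring
    _ ≤ 12 * (2 ^ 50 * Real.exp (54 * (n * Real.log n))) * Real.exp (-4e-6 * m) := by
        gcongr
        exact net_size_sq_le hn
    _ ≤ 12 * (2 ^ 50 * Real.exp (2e-6 * m)) * Real.exp (-4e-6 * m) := by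
        -- Since 108 / 4e-6 = 54 / 2e-6, half of the decay rate pays for the net.
        have h : 54 * (n * Real.log n) ≤ 2e-6 * (m : ℝ) := by
          norm_num at hmn ⊢
          linarith
        have := Real.exp_le_exp.2 h
        gcongr
    _ = 12 * 2 ^ 50 * (Real.exp (2e-6 * m) * Real.exp (-4e-6 * m)) := by ring
    _ = _ := by
        rw [← Real.exp_add]
        congr 2
        ring

end MedianRWF

end

theorem proposition7 :
    ∃ c₀ c₁ c₂ : ℝ, 0 < c₀ ∧ 0 < c₁ ∧ 0 < c₂ ∧
      ∀ ε : ℝ, 0 < ε → ∀ m n : ℕ, c₀ * n * Real.log n < m →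
        ∀ (Ω : Type*) [MeasurableSpace Ω] (P : Measure Ω) [IsProbabilityMeasure P]
          (a : Fin m → Ω → EuclideanSpace ℝ (Fin n)), MedianRWF.IsGaussianSample P a →
          ∃ E : Set Ω, MeasurableSet E ∧ 1 - c₁ * Real.exp (-c₂ * m) ≤ P.real E ∧
            ∀ ω ∈ E, ∀ x z : EuclideanSpace ℝ (Fin n), z ≠ 0 → ‖z - x‖ / ‖z‖ ≤ 1 / 20 →
              (0.88 - MedianRWF.zeta₁ 5 (‖z - x‖ / ‖x‖) - MedianRWF.zeta₂ 5 - ε) * ‖z - x‖ ^ 2 ≤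
                inner ℝ
                  (MedianRWF.truncatedGradient 5 (fun i => a i ω)
                    (MedianRWF.noiseFree (fun i => a i ω) x) z)
                  (z - x) := by
  refine ⟨108 / 4e-6, 12 * 2 ^ 50, 2e-6, by norm_num, by norm_num, by norm_num, ?_⟩
  intro ε hε m n hmn Ω _ P _ a ha
  rcases Nat.eq_zero_or_pos n with rfl | hn
  · refine ⟨Set.univ, MeasurableSet.univ, ?_, fun ω _ x z hz => (hz (Subsingleton.elim _ _)).elim⟩
    rw [probReal_univ]
    linarith [show (0 : ℝ) ≤ 12 * 2 ^ 50 * Real.exp (-2e-6 * m) by positivity]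
  have hm : 0 < m := by
    have h : 0 ≤ 108 / 4e-6 * (n : ℝ) * Real.log n :=
      mul_nonneg (by positivity) (Real.log_natCast_nonneg n)
    exact_mod_cast h.trans_lt hmn
  set B := {ω | ¬ MedianRWF.UniformBounds fun i => a i ω} with hB
  -- B involves uncountably many directions, so a measurable hull of the same measure replaces it.
  refine ⟨(toMeasurable P B)ᶜ, (measurableSet_toMeasurable P B).compl, ?_, ?_⟩
  · rw [measureReal_compl (measurableSet_toMeasurable P B), probReal_univ, measureReal_def P,
      measure_toMeasurable]
    linarith [MedianRWF.measure_not_uniformBounds_le hm hn hmn ha, measureReal_def P B]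
  · intro ω hω x z hz hxz
    have hU : MedianRWF.UniformBounds fun i => a i ω := by
      by_contra h
      exact hω (subset_toMeasurable P B h)
    refine le_trans ?_ (hU.le_inner_truncatedGradient hm hz hxz)
    have h1 := MedianRWF.half_le_zeta₁ (α := 5) (r := ‖z - x‖ / ‖x‖) (by norm_num) (by positivity)
    have h2 := MedianRWF.zeta₂_nonneg 5
    gcongr
    linarith
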